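/- Let $d\in\{2,3\}$, let $D\subset\mathbb R^d$ be a bounded polyhedral open set with a conforming mesh of finitely many nondegenerate $d$-simplices $K_1,\dots,K_{N_K}$, and let $E_1,\dots,E_{N_E}$ be the internal edges ($d=2$) or faces ($d=3$) of the mesh, each with a unit normal $n$ of arbitrary orientation. Let $(\mathbb P_2)^d$ be the space of continuous vector fields on $\overline D$ that vanish on $\partial D$ and whose components are polynomials of degree at most $2$ on each $K_k$; let $\mathbb P_{1,disc}$ be the space of (discontinuous) functions that are polynomials of degree at most $1$ on each $K_k$; let $(\mathbb P_0)^{d(d+1)/2}$ be the space of symmetric $d\times d$ matrix fields that are constant on each $K_k$. Write $(\nabla u)_{ij}=\partial_j u_i$, $A:B=\sum_{i,j}A_{ij}B_{ij}$, $(w\cdot\nabla u)_i=\sum_j w_j\partial_j u_i$. Let $\mathrm{Re}\ge 0$, $\mathrm{Wi}>0$, $0\le\varepsilon<1$, $T>0$, $N_T\ge 1$ and $\Delta t=T/N_T$. Let $(u_h^n,p_h^n,\psi_h^n)_{0\le n\le N_T}$ in $(\mathbb P_2)^d\times\mathbb P_{1,disc}\times(\mathbb P_0)^{d(d+1)/2}$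 be a solution of the following scheme, where the initial velocity is discretely divergence free: $\int_D q\,\mathrm{div}\,u_h^0=0$ for all $q\in\mathbb P_{1,disc}$. For every $0\le n<N_T$ there are antisymmetric matrix fields $\Omega_h^{n+1},N_h^{n+1}$ and a symmetric matrix field $B_h^{n+1}$ commuting with $e^{\psi_h^{n+1}}$, all with entries in $\mathbb P_{1,disc}$, such that $\nabla u_h^{n+1}=\Omega_h^{n+1}+B_h^{n+1}+N_h^{n+1}e^{-\psi_h^{n+1}}$ in each element, and such that for all test functions $(v,q,\phi)\in(\mathbb P_2)^d\times\mathbb P_{1,disc}\times(\mathbb P_0)^{d(d+1)/2}$ $$ \begin{aligned} 0=\sum_{k=1}^{N_K}\int_{K_k}\Big[&\mathrm{Re}\Big(\frac{u_h^{n+1}-u_h^n}{\Delta t}+u_h^n\cdot\nabla u_h^{n+1}\Big)\cdot v-p_h^{n+1}\,\mathrm{div}\,v+q\,\mathrm{div}\,u_h^{n+1}\\ &+(1-\varepsilon)\nabla u_h^{n+1}:\nabla v+\frac{\varepsilon}{\mathrm{Wi}}e^{\psi_h^{n+1}}:\nabla v+\frac{\psi_h^{n+1}-\psi_h^n}{\Delta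 t}:\phi\\ &-(\Omega_h^{n+1}\psi_h^{n+1}-\psi_h^{n+1}\Omega_h^{n+1}):\phi-2B_h^{n+1}:\phi-\frac1{\mathrm{Wi}}(e^{-\psi_h^{n+1}}-I):\phi\Big]\\ &+\sum_{j=1}^{N_E}\int_{E_j}|u_h^n\cdot n|\,[\![\psi_h^{n+1}]\!]:\phi^+ , \end{aligned} $$ where, on the internal edges, $\phi^{\pm}(x)=\lim_{\delta\to0^{\pm}}\phi(x+\delta u_h^n(x))$ and $[\![\phi]\!]=\phi^+-\phi^-$. Then the free energy $$F_h^n=\frac{\mathrm{Re}}2\int_D|u_h^n|^2+\frac{\varepsilon}{2\mathrm{Wi}}\int_D\mathrm{tr}\big(e^{\psi_h^n}-\psi_h^n-I\big)$$ satisfies, for all $0\le n<N_T$, $$F_h^{n+1}-F_h^n+\int_D\frac{\mathrm{Re}}2|u_h^{n+1}-u_h^n|^2+\Delta t\int_D\Big[(1-\varepsilon)|\nabla u_h^{n+1}|^2+\frac{\varepsilon}{2\mathrm{Wi}^2}\mathrm{tr}\big(e^{\psi_h^{n+1}}+e^{-\psi_h^{n+1}}-2I\big)\Big]\le 0 .$$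 In particular, the sequence $(F_h^n)_{0\le n\le N_T}$ is non-increasing. -/

import Mathlib

open MeasureTheory Topology Filter
open scoped RealInnerProductSpace

namespace OldroydB

noncomputable section

/-- Points and vectors of `ℝ^d`, with the Euclidean norm. -/
abbrev Vec (d : ℕ) := EuclideanSpace ℝ (Fin d)

/-- Real `d × d` matrices (rank-two tensors). -/
abbrev Mat (d : ℕ) := Matrix (Fin d) (Fin d) ℝ

/-- The double contraction `A : B = ∑ᵢⱼ Aᵢⱼ Bᵢⱼ`. -/
def ddot {d : ℕ} (A B : Mat d) : ℝ := ∑ i, ∑ j, A i j * B i j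

/-- The velocity gradient, `(∇u)ᵢⱼ = ∂ⱼ uᵢ`. For a finite element field it is the classical
gradient in the interior of every element, hence almost everywhere. -/
def grad {d : ℕ} (u : Vec d → Vec d) (x : Vec d) : Mat d :=
  Matrix.of fun i j => fderiv ℝ u x (EuclideanSpace.single j 1) i

/-- The divergence `div u = tr ∇u`. -/
def divg {d : ℕ} (u : Vec d → Vec d) (x : Vec d) : ℝ := (grad u x).trace

/-- A conforming simplicial mesh of the open set `D`: finitely many nondegenerate `d`-simplices,
each given by its finite set of `d + 1` vertices, whose union is `closure D`, whose interiors lie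
in `D`, and any two of which meet in the common face spanned by their common vertices
(possibly empty). -/
structure Mesh (d : ℕ) (D : Set (Vec d)) where
  /-- The vertex sets of the elements. -/
  cells : Finset (Finset (Vec d))
  card_eq : ∀ s ∈ cells, s.card = d + 1
  affineIndependent : ∀ s ∈ cells, AffineIndependent ℝ ((↑) : s → Vec d)
  conforming : ∀ s ∈ cells, ∀ t ∈ cells,
    convexHull ℝ (s : Set (Vec d)) ∩ convexHull ℝ (t : Set (Vec d)) =
      convexHull ℝ ((s : Set (Vec d)) ∩ (t : Set (Vec d)))
  closure_eq : closure D = ⋃ s ∈ cells, convexHull ℝ (s : Set (Vec d))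
  interior_subset : ∀ s ∈ cells, interior (convexHull ℝ (s : Set (Vec d))) ⊆ D

namespace Mesh

variable {d : ℕ} {D : Set (Vec d)}

open Classical in
/-- The internal edges (`d = 2`) or faces (`d = 3`) of the mesh, given by their vertex sets: the
`(d - 1)`-dimensional faces that are common to two distinct elements. -/
def internalFaces (M : Mesh d D) : Finset (Finset (Vec d)) :=
  (M.cells.offDiag.image fun p => p.1 ∩ p.2).filter fun f => f.card = d

/-- `ν` associates to every internal edge a unit vector orthogonal to it (of any orientation). -/
def IsUnitNormal (M : Mesh d D) (ν : Finset (Vec d) → Vec d) : Prop :=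
  ∀ f ∈ M.internalFaces, ‖ν f‖ = 1 ∧ ∀ x ∈ f, ∀ y ∈ f, ⟪x - y, ν f⟫ = 0

/-- The space `P_{k,disc}`: in the interior of every element, `g` is a polynomial function of
total degree at most `k`. -/
def IsPiecewisePoly (M : Mesh d D) (k : ℕ) (g : Vec d → ℝ) : Prop :=
  ∀ s ∈ M.cells, ∃ P : MvPolynomial (Fin d) ℝ, P.totalDegree ≤ k ∧
    ∀ x ∈ interior (convexHull ℝ (s : Set (Vec d))), g x = MvPolynomial.eval (fun i => x i) P

/-- The velocity space `(P₂)^d`: continuous vector fields on `closure D` with elementwise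
quadratic components, vanishing on `∂D`. -/
def IsVelocity (M : Mesh d D) (u : Vec d → Vec d) : Prop :=
  ContinuousOn u (closure D) ∧ (∀ x ∈ frontier D, u x = 0) ∧
    ∀ i, M.IsPiecewisePoly 2 fun x => u x i

/-- The pressure space `P_{1,disc}`. -/
def IsPressure (M : Mesh d D) (p : Vec d → ℝ) : Prop := M.IsPiecewisePoly 1 p

/-- The stress space `(P₀)^{d(d+1)/2}`: elementwise constant symmetric tensor fields. -/
def IsStress (M : Mesh d D) (ψ : Vec d → Mat d) : Prop :=
  ∀ s ∈ M.cells, ∃ A : Mat d, A.IsSymm ∧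
    ∀ x ∈ interior (convexHull ℝ (s : Set (Vec d))), ψ x = A

/-- The discrete incompressibility constraint that defines `(P₂)^d_{div = 0}` in `(P₂)^d`. -/
def IsDiscretelyDivFree (M : Mesh d D) (u : Vec d → Vec d) : Prop :=
  ∀ q : Vec d → ℝ, M.IsPressure q → ∫ x in D, q x * divg u x = 0

/-- The elementwise decomposition `∇u = Ω + B + N e^{-ψ}` with `Ω`, `N` antisymmetric, `B` symmetric
and commuting with `e^ψ`, all three with entries in `P_{1,disc}`. -/
structure IsDecomposition (M : Mesh d D) (u : Vec d → Vec d) (ψ Ω B N : Vec d → Mat d) :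
    Prop where
  poly_Ω : ∀ i j, M.IsPiecewisePoly 1 fun x => Ω x i j
  poly_B : ∀ i j, M.IsPiecewisePoly 1 fun x => B x i j
  poly_N : ∀ i j, M.IsPiecewisePoly 1 fun x => N x i j
  pointwise : ∀ s ∈ M.cells, ∀ x ∈ interior (convexHull ℝ (s : Set (Vec d))),
    (Ω x).transpose = -Ω x ∧ (N x).transpose = -N x ∧ (B x).IsSymm ∧
      Commute (B x) (NormedSpace.exp (ψ x)) ∧
      grad u x = Ω x + B x + N x * NormedSpace.exp (-ψ x)

end Mesh

/-- The downstream value `φ⁺(x) = lim_{δ → 0⁺} φ(x + δ u(x))`. For elementwise constant `φ` and `x`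
in the relative interior of an internal edge this limit exists whenever `u(x)` is not tangent to
the edge; otherwise it is multiplied by `|u(x) · n| = 0` below. -/
def downstream {d : ℕ} (u : Vec d → Vec d) (φ : Vec d → Mat d) (x : Vec d) : Mat d :=
  limUnder (𝓝[>] (0 : ℝ)) fun δ => φ (x + δ • u x)

/-- The upstream value `φ⁻(x) = lim_{δ → 0⁻} φ(x + δ u(x))`. -/
def upstream {d : ℕ} (u : Vec d → Vec d) (φ : Vec d → Mat d) (x : Vec d) : Mat d :=
  limUnder (𝓝[<] (0 : ℝ)) fun δ => φ (x + δ • u x)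

/-- The jump `⟦φ⟧ = φ⁺ - φ⁻` with respect to the velocity `u`. -/
def jump {d : ℕ} (u : Vec d → Vec d) (φ : Vec d → Mat d) (x : Vec d) : Mat d :=
  downstream u φ x - upstream u φ x

/-- The left-hand side of the variational formulation of one step of the discontinuous Galerkin
scheme for the log-formulation: `(u₀, ψ₀)` are the velocity and log-conformation at the old time,
`(u, p, ψ)` the unknowns at the new time with `∇u = Ω + B + N e^{-ψ}`, and `(v, q, φ)` the test
functions. The edge integrals are with respect to the `(d - 1)`-dimensional surface measure. -/
def logP0DGForm {d : ℕ} {D : Set (Vec d)} (M : Mesh d D) (ν : Finset (Vec d) → Vec d)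
    (Re Wi ε Δt : ℝ) (u₀ : Vec d → Vec d) (ψ₀ : Vec d → Mat d)
    (u : Vec d → Vec d) (p : Vec d → ℝ) (ψ Ω B : Vec d → Mat d)
    (v : Vec d → Vec d) (q : Vec d → ℝ) (φ : Vec d → Mat d) : ℝ :=
  (∑ s ∈ M.cells, ∫ x in convexHull ℝ (s : Set (Vec d)),
    (Re * ⟪(1 / Δt) • (u x - u₀ x) + fderiv ℝ u x (u₀ x), v x⟫
      - p x * divg v x + q x * divg u x + (1 - ε) * ddot (grad u x) (grad v x)
      + ε / Wi * ddot (NormedSpace.exp (ψ x)) (grad v x)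
      + ddot ((1 / Δt) • (ψ x - ψ₀ x)) (φ x)
      - ddot (Ω x * ψ x - ψ x * Ω x) (φ x)
      - 2 * ddot (B x) (φ x)
      - 1 / Wi * ddot (NormedSpace.exp (-ψ x) - 1) (φ x)))
  + ∑ f ∈ M.internalFaces, ∫ x in convexHull ℝ (f : Set (Vec d)),
      |⟪u₀ x, ν f⟫| * ddot (jump u₀ ψ x) (downstream u₀ φ x) ∂μHE[d - 1]

/-- `(u, p, ψ)` solves one step of the scheme starting from `(u₀, ψ₀)`. -/
def IsLogP0DGStep {d : ℕ} {D : Set (Vec d)} (M : Mesh d D) (ν : Finset (Vec d) → Vec d)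
    (Re Wi ε Δt : ℝ) (u₀ : Vec d → Vec d) (ψ₀ : Vec d → Mat d)
    (u : Vec d → Vec d) (p : Vec d → ℝ) (ψ : Vec d → Mat d) : Prop :=
  M.IsVelocity u ∧ M.IsPressure p ∧ M.IsStress ψ ∧
    ∃ Ω B N : Vec d → Mat d, M.IsDecomposition u ψ Ω B N ∧
      ∀ (v : Vec d → Vec d) (q : Vec d → ℝ) (φ : Vec d → Mat d),
        M.IsVelocity v → M.IsPressure q → M.IsStress φ →
          logP0DGForm M ν Re Wi ε Δt u₀ ψ₀ u p ψ Ω B v q φ = 0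

/-- `(uⁿ, pⁿ, ψⁿ)` for `0 ≤ n ≤ NT` is a solution of the scheme: the initial data lie in the finite
element spaces, and every later term solves the step that starts from its predecessor. -/
structure IsLogP0DGSolution {d : ℕ} {D : Set (Vec d)} (M : Mesh d D)
    (ν : Finset (Vec d) → Vec d) (Re Wi ε Δt : ℝ) (NT : ℕ)
    (u : ℕ → Vec d → Vec d) (p : ℕ → Vec d → ℝ) (ψ : ℕ → Vec d → Mat d) : Prop where
  velocity_zero : M.IsVelocity (u 0)
  pressure_zero : M.IsPressure (p 0)
  stress_zero : M.IsStress (ψ 0)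
  step : ∀ n < NT,
    IsLogP0DGStep M ν Re Wi ε Δt (u n) (ψ n) (u (n + 1)) (p (n + 1)) (ψ (n + 1))

/-- The free energy `F(u, e^ψ) = Re/2 ∫_D |u|² + ε/(2 Wi) ∫_D tr(e^ψ - ψ - I)`. -/
def freeEnergy {d : ℕ} (D : Set (Vec d)) (Re Wi ε : ℝ)
    (u : Vec d → Vec d) (ψ : Vec d → Mat d) : ℝ :=
  Re / 2 * (∫ x in D, ‖u x‖ ^ 2)
    + ε / (2 * Wi) * ∫ x in D, (NormedSpace.exp (ψ x) - ψ x - 1).trace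

end

end OldroydB

open OldroydB

namespace OldroydB

/-! This is an energy estimate. One step of the scheme is tested with `v = u`, `q = p` and `φ = ε/(2
Wi) (e^ψ - I)`, all taken at the new time; `φ` is admissible because `ψ` is elementwise constant.
The pressure terms cancel. The divergence of a quadratic velocity is itself an admissible pressure
test, so discrete incompressibility gives zero divergence inside every element
(`Mesh.IsVelocity.divg_ae_eq_zero`). Hence `tr B = 0`, and `stress_energy_identity` turns the
stress, rotation, stretching and relaxation terms into the dissipation of `ψ`.

Three kinds of terms remain. The time increments are handled by polarization for the velocity and by
Klein's inequality for `ψ` (`trace_exp_sub_le`, `trace_increment_le_ddot`). Convection integrates to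
zero, being half the divergence of `|u|² u₀` (`setIntegral_convection_eq_zero`). The edge terms are
nonnegative (`sum_setIntegral_jump_nonneg`): Klein's inequality bounds each one below by a flux of
the entropy `tr (e^ψ - ψ)` through the face, and these fluxes add up to zero.

The last two facts rest on the divergence theorem with Hausdorff measure on the faces. On one
simplex it follows from Fubini along the edges, written in barycentric coordinates
(`setIntegral_fderiv_edge`, `setIntegral_divg_convexHull_range`). On the mesh
(`Mesh.sum_mul_setIntegral_divg`) every face is either shared by exactly two elements lying on
opposite sides (`Mesh.exists_isAdjacentPair`), or almost all of it lies on the boundary, where the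
velocity vanishes (`Mesh.mem_frontier_of_notMem_internalFaces`). -/

/-! ### Matrix analysis: Klein's inequality and the stress identity. -/

theorem ddot_eq_trace {d : ℕ} (A B : Mat d) : ddot A B = (A.transpose * B).trace := by
  simp only [ddot, Matrix.trace, Matrix.diag, Matrix.mul_apply, Matrix.transpose_apply]
  exact Finset.sum_comm

theorem ddot_self_nonneg {d : ℕ} (A : Mat d) : 0 ≤ ddot A A :=
  Finset.sum_nonneg fun _ _ => Finset.sum_nonneg fun _ _ => mul_self_nonneg _

theorem ddot_smul_left {d : ℕ} (c : ℝ) (A B : Mat d) : ddot (c • A) B = c * ddot A B := by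
  simp [ddot_eq_trace]

theorem ddot_smul_right {d : ℕ} (c : ℝ) (A B : Mat d) : ddot A (c • B) = c * ddot A B := by
  simp [ddot_eq_trace]

/-- A real symmetric matrix and its exponential are simultaneously diagonalizable. -/
theorem exists_orthogonal_diagonalization {d : ℕ} {A : Mat d} (hA : A.IsSymm) :
    ∃ (U : Mat d) (v : Fin d → ℝ), U * U.transpose = 1 ∧ U.transpose * U = 1 ∧
      A = U * Matrix.diagonal v * U.transpose ∧
      NormedSpace.exp A = U * Matrix.diagonal (fun i => Real.exp (v i)) * U.transpose := by
  have hH : A.IsHermitian := by rwa [Matrix.IsHermitian, Matrix.conjTranspose_eq_transpose_of_trivial]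
  set U : Mat d := (hH.eigenvectorUnitary : Mat d)
  have h1 : U * U.transpose = 1 := by
    have := (Matrix.mem_unitaryGroup_iff).1 hH.eigenvectorUnitary.2
    rwa [Matrix.star_eq_conjTranspose, Matrix.conjTranspose_eq_transpose_of_trivial] at this
  have h2 : U.transpose * U = 1 := by
    have := (Matrix.mem_unitaryGroup_iff').1 hH.eigenvectorUnitary.2
    rwa [Matrix.star_eq_conjTranspose, Matrix.conjTranspose_eq_transpose_of_trivial] at this
  have h3 : A = U * Matrix.diagonal hH.eigenvalues * U.transpose := by
    have := hH.spectral_theorem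
    rw [Unitary.conjStarAlgAut_apply] at this
    simpa [Matrix.star_eq_conjTranspose, Matrix.conjTranspose_eq_transpose_of_trivial] using this
  refine ⟨U, hH.eigenvalues, h1, h2, h3, ?_⟩
  have hinv : U⁻¹ = U.transpose := Matrix.inv_eq_right_inv h1
  have hu : IsUnit U := ⟨⟨U, U.transpose, h1, h2⟩, rfl⟩
  conv_lhs => rw [h3, ← hinv, Matrix.exp_conj U _ hu, Matrix.exp_diagonal, hinv]
  congr 3
  funext i
  rw [Pi.coe_exp, ← Real.exp_eq_exp_ℝ]

/-- The weights are squares, hence nonnegative. A trace inequality for two symmetric matrices that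
need not commute thus reduces to a scalar inequality for each pair of eigenvalues. -/
theorem trace_conj_diagonal_mul {d : ℕ} (U V : Mat d) (e m : Fin d → ℝ) :
    (V * Matrix.diagonal m * V.transpose * (U * Matrix.diagonal e * U.transpose)).trace =
      ∑ i, ∑ j, (U.transpose * V) i j ^ 2 * (m j * e i) := by
  have h : (V * Matrix.diagonal m * V.transpose * (U * Matrix.diagonal e * U.transpose)).trace =
      ((U.transpose * V) * Matrix.diagonal m * ((U.transpose * V).transpose *
        Matrix.diagonal e)).trace := by
    rw [← Matrix.mul_assoc, Matrix.trace_mul_comm, Matrix.transpose_mul, Matrix.transpose_transpose]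
    simp only [Matrix.mul_assoc]
  rw [h, Matrix.trace]
  refine Finset.sum_congr rfl fun i _ => ?_
  rw [Matrix.diag, Matrix.mul_apply]
  refine Finset.sum_congr rfl fun j _ => ?_
  rw [Matrix.mul_diagonal, Matrix.mul_diagonal, Matrix.transpose_apply]
  ring

/-- Klein's inequality for the exponential. -/
theorem trace_exp_sub_le {d : ℕ} {A B : Mat d} (hA : A.IsSymm) (hB : B.IsSymm) :
    (NormedSpace.exp A).trace - (NormedSpace.exp B).trace ≤
      ((A - B) * NormedSpace.exp A).trace := by
  obtain ⟨U, l, hU1, hU2, hAU, hAe⟩ := exists_orthogonal_diagonalization hA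
  obtain ⟨V, m, hV1, hV2, hBV, hBe⟩ := exists_orthogonal_diagonalization hB
  -- The identity is diagonal in every orthonormal frame, so traces involving only one of the two
  -- matrices can be written with the same weights as the mixed trace.
  have one (W : Mat d) (hW : W * W.transpose = 1) :
      W * Matrix.diagonal (fun _ => (1 : ℝ)) * W.transpose = 1 := by
    rw [Matrix.diagonal_one, Matrix.mul_one, hW]
  have e1 : (NormedSpace.exp A).trace =
      ∑ i, ∑ j, (U.transpose * V) i j ^ 2 * (1 * Real.exp (l i)) := by
    rw [← trace_conj_diagonal_mul, one V hV1, hAe, Matrix.one_mul]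
  have e2 : (NormedSpace.exp B).trace =
      ∑ i, ∑ j, (U.transpose * V) i j ^ 2 * (Real.exp (m j) * 1) := by
    rw [← trace_conj_diagonal_mul U V (fun _ => 1), one U hU1, hBe, Matrix.mul_one]
  have e3 : (B * NormedSpace.exp A).trace =
      ∑ i, ∑ j, (U.transpose * V) i j ^ 2 * (m j * Real.exp (l i)) := by
    rw [← trace_conj_diagonal_mul, hAe, ← hBV]
  have e4 : (A * NormedSpace.exp A).trace =
      ∑ i, ∑ j, (U.transpose * V) i j ^ 2 * (1 * (l i * Real.exp (l i))) := by
    rw [← trace_conj_diagonal_mul U V (fun i => l i * Real.exp (l i)), one V hV1, Matrix.one_mul,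
      hAe]
    nth_rewrite 1 [hAU]
    rw [show U * Matrix.diagonal l * U.transpose *
      (U * Matrix.diagonal (fun i => Real.exp (l i)) * U.transpose) =
      U * Matrix.diagonal l * (U.transpose * U) *
        Matrix.diagonal (fun i => Real.exp (l i)) * U.transpose by
        simp only [Matrix.mul_assoc], hU2, Matrix.mul_one, Matrix.mul_assoc U,
        Matrix.diagonal_mul_diagonal]
  rw [Matrix.sub_mul, Matrix.trace_sub, e1, e2, e3, e4]
  simp only [← Finset.sum_sub_distrib]
  refine Finset.sum_le_sum fun i _ => Finset.sum_le_sum fun j _ => ?_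
  rw [← mul_sub, ← mul_sub]
  refine mul_le_mul_of_nonneg_left ?_ (sq_nonneg _)
  -- Multiplied by `exp (l i)`, this tangent line bound is the convexity inequality `e^l - e^m ≤ (l
  -- - m) e^l`.
  have h := Real.add_one_le_exp (m j - l i)
  have h2 : Real.exp (m j) = Real.exp (m j - l i) * Real.exp (l i) := by
    rw [← Real.exp_add]; ring_nf
  have h3 := Real.exp_pos (l i)
  rw [h2]
  nlinarith [mul_le_mul_of_nonneg_right h h3.le]

theorem isSymm_exp {d : ℕ} {A : Mat d} (hA : A.IsSymm) : (NormedSpace.exp A).IsSymm :=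
  hA.exp

theorem exp_mul_exp_neg {d : ℕ} (A : Mat d) :
    NormedSpace.exp A * NormedSpace.exp (-A) = 1 := by
  rw [← Matrix.exp_add_of_commute _ _ (Commute.refl A).neg_right, add_neg_cancel,
    NormedSpace.exp_zero]

theorem exp_neg_mul_exp {d : ℕ} (A : Mat d) :
    NormedSpace.exp (-A) * NormedSpace.exp A = 1 := by
  simpa using exp_mul_exp_neg (-A)

theorem trace_mul_eq_zero_of_isSymm_of_antisymm {d : ℕ} {S N : Mat d} (hS : S.IsSymm)
    (hN : N.transpose = -N) : (S * N).trace = 0 := by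
  have h : (S * N).trace = -(S * N).trace := by
    conv_lhs => rw [← Matrix.trace_transpose, Matrix.transpose_mul, hN, hS.eq, Matrix.neg_mul,
      Matrix.trace_neg, Matrix.trace_mul_comm]
  linarith

/-- Klein's inequality is applied at `0` against `A` and against `-A`; the linear terms cancel in
the sum. -/
theorem trace_exp_add_exp_neg_nonneg {d : ℕ} {A : Mat d} (hA : A.IsSymm) :
    0 ≤ (NormedSpace.exp A + NormedSpace.exp (-A) - (2 : ℝ) • (1 : Mat d)).trace := by
  have h0 : (0 : Mat d).IsSymm := Matrix.isSymm_zero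
  have h1 := trace_exp_sub_le h0 hA
  have h2 := trace_exp_sub_le h0 hA.neg
  simp only [NormedSpace.exp_zero, Matrix.mul_one, zero_sub, Matrix.trace_neg, neg_neg] at h1 h2
  simp only [Matrix.trace_sub, Matrix.trace_add, Matrix.trace_smul, smul_eq_mul]
  linarith

/-- Klein's inequality in the form in which it bounds increments of `tr (e^ψ - ψ)`. -/
theorem trace_increment_le_ddot {d : ℕ} {A B : Mat d} (hA : A.IsSymm) (hB : B.IsSymm) :
    (NormedSpace.exp A - A).trace - (NormedSpace.exp B - B).trace ≤
      ddot (A - B) (NormedSpace.exp A - 1) := by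
  have h := trace_exp_sub_le hA hB
  rw [ddot_eq_trace, (hA.sub hB).eq, Matrix.mul_sub, Matrix.mul_one]
  simp only [Matrix.trace_sub] at h ⊢
  linarith

/-- The contributions of the decomposition `∇u = Ω + B + N e^{-ψ}` to the energy balance. -/
theorem stress_energy_identity {d : ℕ} {ψ G Ω B N : Mat d} (hψ : ψ.IsSymm)
    (hΩ : Ω.transpose = -Ω) (hN : N.transpose = -N) (hB : B.IsSymm)
    (hG : G = Ω + B + N * NormedSpace.exp (-ψ)) (hdiv : G.trace = 0) (Wi ε : ℝ) :
    ε / Wi * ddot (NormedSpace.exp ψ) G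
        - ddot (Ω * ψ - ψ * Ω) ((ε / (2 * Wi)) • (NormedSpace.exp ψ - 1))
        - 2 * ddot B ((ε / (2 * Wi)) • (NormedSpace.exp ψ - 1))
        - 1 / Wi * ddot (NormedSpace.exp (-ψ) - 1) ((ε / (2 * Wi)) • (NormedSpace.exp ψ - 1)) =
      ε / (2 * Wi ^ 2) *
        (NormedSpace.exp ψ + NormedSpace.exp (-ψ) - (2 : ℝ) • (1 : Mat d)).trace := by
  have hE := isSymm_exp hψ
  have hE' := isSymm_exp hψ.neg
  have hc : ψ * NormedSpace.exp ψ = NormedSpace.exp ψ * ψ :=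
    ((Commute.refl ψ).exp_right).eq
  have h1 : ddot (NormedSpace.exp ψ) G = (NormedSpace.exp ψ * B).trace := by
    rw [ddot_eq_trace, hE.eq, hG, Matrix.mul_add, Matrix.mul_add, Matrix.trace_add,
      Matrix.trace_add, trace_mul_eq_zero_of_isSymm_of_antisymm hE hΩ, Matrix.trace_mul_comm _ (N * _),
      Matrix.mul_assoc, exp_neg_mul_exp, Matrix.mul_one]
    have := trace_mul_eq_zero_of_isSymm_of_antisymm (Matrix.isSymm_one (n := Fin d)) hN
    rw [Matrix.one_mul] at this
    rw [this]; ring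
  -- Incompressibility enters here: the two antisymmetric contributions are traceless, so all of `tr
  -- G` is `tr B`.
  have hBt : B.trace = 0 := by
    rw [hG, Matrix.trace_add, Matrix.trace_add, Matrix.trace_mul_comm N,
      trace_mul_eq_zero_of_isSymm_of_antisymm hE' hN] at hdiv
    have := trace_mul_eq_zero_of_isSymm_of_antisymm (Matrix.isSymm_one (n := Fin d)) hΩ
    rw [Matrix.one_mul] at this
    linarith
  -- A commutator with `ψ` is orthogonal to every function of `ψ`, by cyclicity of the trace.
  have h2 : ddot (Ω * ψ - ψ * Ω) (NormedSpace.exp ψ - 1) = 0 := by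
    have hs : (Ω * ψ - ψ * Ω).transpose = Ω * ψ - ψ * Ω := by
      rw [Matrix.transpose_sub, Matrix.transpose_mul, Matrix.transpose_mul, hΩ, hψ.eq]
      simp only [Matrix.neg_mul, Matrix.mul_neg]; abel
    have h3 : (Ω * ψ * NormedSpace.exp ψ).trace = (ψ * Ω * NormedSpace.exp ψ).trace := by
      rw [Matrix.mul_assoc, hc, ← Matrix.mul_assoc, Matrix.trace_mul_comm _ ψ, ← Matrix.mul_assoc]
    rw [ddot_eq_trace, hs, Matrix.mul_sub, Matrix.mul_one, Matrix.sub_mul, Matrix.trace_sub,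
      Matrix.trace_sub, Matrix.trace_sub, h3, Matrix.trace_mul_comm Ω]
    ring
  have h3 : ddot B (NormedSpace.exp ψ - 1) = (NormedSpace.exp ψ * B).trace := by
    rw [ddot_eq_trace, hB.eq, Matrix.mul_sub, Matrix.mul_one, Matrix.trace_sub, hBt,
      Matrix.trace_mul_comm]
    ring
  have h4 : ddot (NormedSpace.exp (-ψ) - 1) (NormedSpace.exp ψ - 1) =
      -(NormedSpace.exp ψ + NormedSpace.exp (-ψ) - (2 : ℝ) • (1 : Mat d)).trace := by
    rw [ddot_eq_trace, (hE'.sub Matrix.isSymm_one).eq, Matrix.sub_mul, Matrix.mul_sub,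
      exp_neg_mul_exp, Matrix.one_mul, Matrix.mul_one, ← Matrix.trace_neg, two_smul]
    congr 1
    abel
  rw [ddot_smul_right, ddot_smul_right, ddot_smul_right, h1, h2, h3, h4]
  rcases eq_or_ne Wi 0 with rfl | h
  · simp
  · field_simp
    ring

/-! ### Hausdorff measure on hyperplanes and Fubini in oblique directions. -/

/-- The hyperplane measure `μHE[d - 1]` on `{x | ⟪g, x⟫ = c}`. -/
noncomputable def hyperplaneMeasure {d : ℕ} (g : Vec d) (c : ℝ) : Measure (Vec d) :=
  μHE[d - 1].restrict {x | ⟪g, x⟫ = c}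

theorem measurableSet_hyperplane {d : ℕ} (g : Vec d) (c : ℝ) :
    MeasurableSet {x : Vec d | ⟪g, x⟫ = c} :=
  (isClosed_eq (by fun_prop) continuous_const).measurableSet

theorem exists_inner_eq {d : ℕ} {g : Vec d} (hg : g ≠ 0) (c : ℝ) : ∃ p : Vec d, ⟪g, p⟫ = c :=
  ⟨(c / ⟪g, g⟫) • g, by
    rw [real_inner_smul_right, div_mul_cancel₀ _ (inner_self_ne_zero.2 hg)]⟩

theorem finrank_orthogonal_span {d : ℕ} {g : Vec d} (hg : g ≠ 0) :
    Module.finrank ℝ (ℝ ∙ g)ᗮ = d - 1 := by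
  have h := (ℝ ∙ g).finrank_add_finrank_orthogonal
  rw [finrank_span_singleton hg, finrank_euclideanSpace_fin] at h
  omega

/-- The hyperplane is an isometric copy of the orthogonal complement of `g`, and isometries carry
Hausdorff measure along. Sigma-finiteness and finiteness on compact sets are inherited from Lebesgue
measure there. -/
theorem hyperplaneMeasure_eq_map {d : ℕ} {g : Vec d} (hg : g ≠ 0) {c : ℝ} {p : Vec d}
    (hp : ⟪g, p⟫ = c) :
    hyperplaneMeasure g c =
      (volume : Measure (ℝ ∙ g)ᗮ).map (fun y : (ℝ ∙ g)ᗮ => (y : Vec d) + p) := by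
  have hi : Isometry (fun y : (ℝ ∙ g)ᗮ => (y : Vec d) + p) :=
    (IsometryEquiv.addRight p).isometry.comp isometry_subtype_coe
  rw [← InnerProductSpace.euclideanHausdorffMeasure_eq_volume, finrank_orthogonal_span hg,
    hi.map_euclideanHausdorffMeasure, hyperplaneMeasure]
  congr 1
  ext x
  simp only [Set.mem_ofPred_eq, Set.mem_range, Subtype.exists, exists_prop]
  constructor
  · intro hx
    refine ⟨x - p, ?_, by simp⟩
    rw [Submodule.mem_orthogonal_singleton_iff_inner_right, inner_sub_right, hx, hp, sub_self]
  · rintro ⟨y, hy, rfl⟩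
    rw [Submodule.mem_orthogonal_singleton_iff_inner_right] at hy
    rw [inner_add_right, hy, hp, zero_add]

theorem sigmaFinite_hyperplaneMeasure {d : ℕ} {g : Vec d} (hg : g ≠ 0) (c : ℝ) :
    SigmaFinite (hyperplaneMeasure g c) := by
  obtain ⟨p, hp⟩ := exists_inner_eq hg c
  rw [hyperplaneMeasure_eq_map hg hp]
  have hi : Isometry (fun y : (ℝ ∙ g)ᗮ => (y : Vec d) + p) :=
    (IsometryEquiv.addRight p).isometry.comp isometry_subtype_coe
  exact hi.isClosedEmbedding.measurableEmbedding.sigmaFinite_map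

theorem hyperplaneMeasure_lt_top {d : ℕ} {g : Vec d} (hg : g ≠ 0) (c : ℝ) {K : Set (Vec d)}
    (hK : IsCompact K) : hyperplaneMeasure g c K < ⊤ := by
  obtain ⟨p, hp⟩ := exists_inner_eq hg c
  have hi : Isometry (fun y : (ℝ ∙ g)ᗮ => (y : Vec d) + p) :=
    (IsometryEquiv.addRight p).isometry.comp isometry_subtype_coe
  rw [hyperplaneMeasure_eq_map hg hp, Measure.map_apply hi.continuous.measurable hK.measurableSet]
  exact (hi.isClosedEmbedding.isCompact_preimage hK).measure_lt_top

/-- Lebesgue measure is, up to a constant, the product of the measure of a hyperplane and the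
length along any transversal direction. -/
theorem volume_eq_hyperplane_prod {d : ℕ} {g e : Vec d} (hge : ⟪g, e⟫ ≠ 0) (c : ℝ) :
    (volume : Measure (Vec d)) = ENNReal.ofReal (|⟪g, e⟫| / ‖g‖) •
      ((hyperplaneMeasure g c).prod volume).map (fun q : Vec d × ℝ => q.1 + q.2 • e) := by
  have hg : g ≠ 0 := by rintro rfl; simp at hge
  have := sigmaFinite_hyperplaneMeasure hg c
  obtain ⟨p, hp⟩ := exists_inner_eq hg c
  have hgn : ‖g‖ ≠ 0 := norm_ne_zero_iff.2 hg
  have hm : Measurable (fun q : Vec d × ℝ => q.1 + q.2 • e) := by fun_prop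
  ext t ht
  have key := EuclideanGeometry.euclideanHausdorffMeasure_eq_lintegral p hg ht
  rw [InnerProductSpace.euclideanHausdorffMeasure_eq_volume, finrank_euclideanSpace_fin] at key
  rw [key, Measure.smul_apply, Measure.map_apply hm ht, Measure.prod_apply_symm (hm ht), smul_eq_mul]
  -- Translating by `s • e` or by `(s * r) • g` changes `⟪g, ·⟫` by the same amount, so oblique
  -- slices are translates of orthogonal ones, reparametrized by the factor `r`.
  set r : ℝ := ⟪g, e⟫ / ‖g‖ ^ 2 with hr
  have hr0 : r ≠ 0 := div_ne_zero hge (pow_ne_zero _ hgn)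
  have hsec (s : ℝ) : hyperplaneMeasure g c ((fun x => (x, s)) ⁻¹' ((fun q : Vec d × ℝ =>
      q.1 + q.2 • e) ⁻¹' t)) = μHE[d - 1] (t ∩ AffineSubspace.mk' ((s * r) • g +ᵥ p) (ℝ ∙ g)ᗮ) := by
    have hms : MeasurableSet ((fun x => (x, s)) ⁻¹' ((fun q : Vec d × ℝ => q.1 + q.2 • e) ⁻¹' t)) :=
      (hm ht).preimage (by fun_prop)
    rw [hyperplaneMeasure, Measure.restrict_apply hms,
      ← measure_preimage_add_right μHE[d - 1] (s • e) (t ∩ _)]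
    congr 1
    ext x
    simp only [Set.mem_inter_iff, Set.mem_preimage, Set.mem_ofPred_eq, SetLike.mem_coe,
      AffineSubspace.mem_mk', vsub_eq_sub, vadd_eq_add,
      Submodule.mem_orthogonal_singleton_iff_inner_right]
    have h : ⟪g, x + s • e - ((s * r) • g + p)⟫ = ⟪g, x⟫ - c := by
      rw [inner_sub_right, inner_add_right, inner_add_right, real_inner_smul_right,
        real_inner_smul_right, real_inner_self_eq_norm_sq, hp, hr]
      field_simp
      ring
    rw [h, sub_eq_zero]
  simp_rw [hsec]
  conv_lhs => rw [← Real.smul_map_volume_mul_right hr0]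
  rw [lintegral_smul_measure, (measurableEmbedding_mulRight₀ hr0).lintegral_map, smul_eq_mul,
    ← mul_assoc]
  congr 1
  rw [← ofReal_norm, ← ENNReal.ofReal_mul (norm_nonneg _)]
  congr 1
  rw [hr, abs_div, abs_of_nonneg (sq_nonneg ‖g‖)]
  field_simp

/-- A hyperplane and a Lebesgue null set: if the set is invariant under translations in a
transversal direction, then it is also null for the hyperplane measure. -/
theorem hyperplaneMeasure_eq_zero {d : ℕ} {g e : Vec d} (hge : ⟪g, e⟫ ≠ 0) (c : ℝ)
    {S : Set (Vec d)} (hS : MeasurableSet S) (hS0 : volume S = 0)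
    (hinv : ∀ x ∈ S, ∀ t : ℝ, x + t • e ∈ S) : hyperplaneMeasure g c S = 0 := by
  have hg : g ≠ 0 := by rintro rfl; simp at hge
  have := sigmaFinite_hyperplaneMeasure hg c
  rw [volume_eq_hyperplane_prod hge c, Measure.smul_apply, smul_eq_mul,
    Measure.map_apply (by fun_prop) hS] at hS0
  have h1 : ENNReal.ofReal (|⟪g, e⟫| / ‖g‖) ≠ 0 := by
    rw [Ne, ENNReal.ofReal_eq_zero, not_le]
    exact div_pos (abs_pos.2 hge) (norm_pos_iff.2 hg)
  have h2 := (mul_eq_zero.1 hS0).resolve_left h1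
  -- By invariance the null set contains a product with a line of infinite length, so the other
  -- factor must be null.
  have h3 : S ×ˢ (Set.univ : Set ℝ) ⊆ (fun q : Vec d × ℝ => q.1 + q.2 • e) ⁻¹' S :=
    fun q hq => hinv _ hq.1 _
  have h4 := measure_mono_null h3 h2
  rw [Measure.prod_prod, Real.volume_univ] at h4
  exact (mul_eq_zero.1 h4).resolve_right ENNReal.top_ne_zero

/-- The measures of two hyperplanes correspond under the projection along a direction that is
transversal to both. -/
theorem hyperplaneMeasure_map_projection {d : ℕ} {g h e : Vec d} {c k : ℝ}
    (hge : ⟪g, e⟫ = 1) (hhe : ⟪h, e⟫ = -1) :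
    ENNReal.ofReal (1 / ‖h‖) • hyperplaneMeasure h k =
      ENNReal.ofReal (1 / ‖g‖) •
        (hyperplaneMeasure g c).map (fun y => y + (⟪h, y⟫ - k) • e) := by
  have hg : g ≠ 0 := by rintro rfl; simp at hge
  have hh : h ≠ 0 := by rintro rfl; simp at hhe
  have := sigmaFinite_hyperplaneMeasure hg c
  have := sigmaFinite_hyperplaneMeasure hh k
  set π : Vec d → Vec d := fun y => y + (⟪h, y⟫ - k) • e with hπ
  have hπm : Measurable π := by fun_prop
  have hπe (y : Vec d) (t : ℝ) : π (y + t • e) = π y := by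
    simp only [hπ, inner_add_right, real_inner_smul_right, hhe]
    module
  ext S hS
  -- An oblique cylinder over `S` of unit height. Its volume is computed twice, by Fubini based on
  -- either hyperplane; on each line the fibre is an interval of length one.
  set A : Set (Vec d) := {x | π x ∈ S ∧ ⟪h, x⟫ - k ∈ Set.Icc (0 : ℝ) 1} with hA
  have hAm : MeasurableSet A :=
    (hπm hS).inter ((show Measurable fun x : Vec d => ⟪h, x⟫ - k by fun_prop) measurableSet_Icc)
  have eqh : volume A = ENNReal.ofReal (1 / ‖h‖) * hyperplaneMeasure h k S := by
    rw [volume_eq_hyperplane_prod (show ⟪h, e⟫ ≠ 0 by rw [hhe]; norm_num) k, Measure.smul_apply,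
      Measure.map_apply (by fun_prop) hAm, smul_eq_mul, hhe, abs_neg, abs_one]
    congr 1
    have : ((hyperplaneMeasure h k).prod volume)
        ((fun q : Vec d × ℝ => q.1 + q.2 • e) ⁻¹' A) =
        ((hyperplaneMeasure h k).prod volume) (S ×ˢ Set.Icc (-1 : ℝ) 0) := by
      have hae : ∀ᵐ q ∂((hyperplaneMeasure h k).prod (volume : Measure ℝ)), ⟪h, q.1⟫ = k := by
        have : ∀ᵐ y ∂(hyperplaneMeasure h k), ⟪h, y⟫ = k :=
          ae_restrict_mem (measurableSet_hyperplane h k)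
        exact Measure.quasiMeasurePreserving_fst.ae this
      refine measure_congr ?_
      filter_upwards [hae] with q hq
      refine propext ?_
      change (π (q.1 + q.2 • e) ∈ S ∧ ⟪h, q.1 + q.2 • e⟫ - k ∈ Set.Icc (0 : ℝ) 1) ↔
        (q.1 ∈ S ∧ q.2 ∈ Set.Icc (-1 : ℝ) 0)
      rw [hπe, show π q.1 = q.1 by simp [hπ, hq], inner_add_right, real_inner_smul_right, hq, hhe]
      simp only [Set.mem_Icc]
      constructor <;> rintro ⟨h1, h2, h3⟩ <;> exact ⟨h1, by linarith, by linarith⟩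
    rw [this, Measure.prod_prod, Real.volume_Icc]
    norm_num
  have eqg : volume A = ENNReal.ofReal (1 / ‖g‖) * hyperplaneMeasure g c (π ⁻¹' S) := by
    rw [volume_eq_hyperplane_prod (show ⟪g, e⟫ ≠ 0 by rw [hge]; norm_num) c, Measure.smul_apply,
      Measure.map_apply (by fun_prop) hAm, smul_eq_mul, hge, abs_one,
      Measure.prod_apply ((show Measurable fun q : Vec d × ℝ => q.1 + q.2 • e by fun_prop) hAm),
      ← lintegral_indicator_one (hπm hS)]
    congr 1
    refine lintegral_congr fun y => ?_
    by_cases hy : π y ∈ S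
    · rw [Set.indicator_of_mem (show y ∈ π ⁻¹' S from hy)]
      have : Prod.mk y ⁻¹' ((fun q : Vec d × ℝ => q.1 + q.2 • e) ⁻¹' A) =
          Set.Icc (⟪h, y⟫ - k - 1) (⟪h, y⟫ - k) := by
        ext t
        change (π (y + t • e) ∈ S ∧ ⟪h, y + t • e⟫ - k ∈ Set.Icc (0 : ℝ) 1) ↔ _
        rw [hπe, inner_add_right, real_inner_smul_right, hhe]
        simp only [Set.mem_Icc]
        constructor
        · rintro ⟨-, h2, h3⟩; exact ⟨by linarith, by linarith⟩
        · rintro ⟨h2, h3⟩; exact ⟨hy, by linarith, by linarith⟩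
      rw [this, Real.volume_Icc]
      simp
    · rw [Set.indicator_of_notMem (show y ∉ π ⁻¹' S from hy)]
      have : Prod.mk y ⁻¹' ((fun q : Vec d × ℝ => q.1 + q.2 • e) ⁻¹' A) = ∅ := by
        ext t
        change (π (y + t • e) ∈ S ∧ ⟪h, y + t • e⟫ - k ∈ Set.Icc (0 : ℝ) 1) ↔ _
        rw [hπe]
        simp [hy]
      rw [this, measure_empty]
  rw [Measure.smul_apply, Measure.smul_apply, Measure.map_apply hπm hS, smul_eq_mul, smul_eq_mul,
    ← eqh, ← eqg]

/-! ### The divergence theorem on one simplex, in barycentric coordinates. -/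

section Simplex

variable {d : ℕ} {ι : Type*} (b : AffineBasis ι ℝ (Vec d))

/-- The gradient of a barycentric coordinate. -/
noncomputable def coordGrad (i : ι) : Vec d :=
  (InnerProductSpace.toDual ℝ (Vec d)).symm (LinearMap.toContinuousLinearMap (b.coord i).linear)

/-- The face of a simplex on which the barycentric coordinate `i` vanishes. -/
def oppositeFace (i : ι) : Set (Vec d) := {x | b.coord i x = 0 ∧ ∀ j, 0 ≤ b.coord j x}

theorem inner_coordGrad (i : ι) (w : Vec d) : ⟪coordGrad b i, w⟫ = (b.coord i).linear w := by
  simp [coordGrad]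

theorem coord_add_smul (i : ι) (x w : Vec d) (t : ℝ) :
    b.coord i (x + t • w) = b.coord i x + t * ⟪coordGrad b i, w⟫ := by
  rw [inner_coordGrad, add_comm, ← vadd_eq_add, AffineMap.map_vadd, map_smul, vadd_eq_add,
    smul_eq_mul, add_comm]

theorem coord_eq_inner (i : ι) (x : Vec d) :
    b.coord i x = ⟪coordGrad b i, x⟫ + b.coord i 0 := by
  have := coord_add_smul b i 0 x 1
  rw [zero_add, one_smul, one_mul] at this
  rw [this, add_comm]

theorem inner_coordGrad_sub (i : ι) (x y : Vec d) :
    ⟪coordGrad b i, x - y⟫ = b.coord i x - b.coord i y := by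
  rw [inner_sub_right, coord_eq_inner b i x, coord_eq_inner b i y]; ring

theorem continuous_coord (i : ι) : Continuous (b.coord i) :=
  continuous_barycentric_coord b i

theorem convexHull_range_eq : convexHull ℝ (Set.range b) = {x | ∀ j, 0 ≤ b.coord j x} :=
  b.convexHull_eq_nonneg_coord

theorem oppositeFace_eq (i : ι) :
    oppositeFace b i = {x | b.coord i x = 0} ∩ convexHull ℝ (Set.range b) := by
  rw [convexHull_range_eq]; rfl

theorem mem_hyperplane_iff (i : ι) (x : Vec d) :
    ⟪coordGrad b i, x⟫ = -(b.coord i 0) ↔ b.coord i x = 0 := by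
  rw [coord_eq_inner b i x]; constructor <;> intro h <;> linarith

theorem coordGrad_ne_zero [Nontrivial ι] (i : ι) : coordGrad b i ≠ 0 := by
  classical
  intro h
  obtain ⟨j, hj⟩ := exists_ne i
  have := inner_coordGrad_sub b i (b i) (b j)
  rw [h, inner_zero_left, b.coord_apply_eq, b.coord_apply_ne hj.symm] at this
  norm_num at this

variable [Fintype ι]

theorem isCompact_convexHull_range : IsCompact (convexHull ℝ (Set.range b)) :=
  (Set.finite_range b).isCompact_convexHull (𝕜 := ℝ)

theorem isCompact_oppositeFace (i : ι) : IsCompact (oppositeFace b i) := by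
  rw [oppositeFace_eq, Set.inter_comm]
  exact (isCompact_convexHull_range b).inter_right
    (isClosed_eq (continuous_coord b i) continuous_const)

/-- In general `μHE[d - 1]` is not finite on compact sets of the whole space, whereas the hyperplane
measure is, and it is sigma-finite as Fubini requires. This allows passage between the two on a
face. -/
theorem hyperplaneMeasure_restrict_oppositeFace (i : ι) :
    (hyperplaneMeasure (coordGrad b i) (-(b.coord i 0))).restrict (oppositeFace b i) =
      μHE[d - 1].restrict (oppositeFace b i) := by
  rw [hyperplaneMeasure, Measure.restrict_restrict (isCompact_oppositeFace b i).measurableSet,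
    Set.inter_eq_left.2]
  intro x hx
  exact (mem_hyperplane_iff b i x).2 hx.1

theorem integrableOn_oppositeFace [Nontrivial ι] {F : Type*} [NormedAddCommGroup F]
    (i : ι) {f : Vec d → F}
    (hf : ContinuousOn f (oppositeFace b i)) : IntegrableOn f (oppositeFace b i) μHE[d - 1] := by
  have : IsFiniteMeasureOnCompacts (hyperplaneMeasure (coordGrad b i) (-(b.coord i 0))) :=
    ⟨fun _ hK => hyperplaneMeasure_lt_top (coordGrad_ne_zero b i) _ hK⟩
  rw [IntegrableOn, ← hyperplaneMeasure_restrict_oppositeFace]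
  exact hf.integrableOn_compact (isCompact_oppositeFace b i)

/-- Each line parallel to the edge that meets the simplex enters through the face opposite `i` and
leaves through the face opposite `j`. The fundamental theorem of calculus on these lines yields
boundary values, and the factors `‖coordGrad‖⁻¹` account for the obliqueness of the faces. -/
theorem setIntegral_fderiv_edge {i j : ι} (hij : i ≠ j) {f : Vec d → ℝ} (hf : ContDiff ℝ 1 f) :
    ∫ x in convexHull ℝ (Set.range b), fderiv ℝ f x (b i - b j) =
      ‖coordGrad b j‖⁻¹ * (∫ x in oppositeFace b j, f x ∂μHE[d - 1]) -
        ‖coordGrad b i‖⁻¹ * ∫ x in oppositeFace b i, f x ∂μHE[d - 1] := by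
  have : Nontrivial ι := ⟨i, j, hij⟩
  set e := b i - b j with he
  set K := convexHull ℝ (Set.range b) with hK
  set g := coordGrad b i with hg
  set h := coordGrad b j with hh
  set σ := hyperplaneMeasure g (-(b.coord i 0)) with hσ
  have hg0 : g ≠ 0 := coordGrad_ne_zero b i
  have hge : ⟪g, e⟫ = 1 := by
    rw [hg, he, inner_coordGrad_sub, b.coord_apply_eq, b.coord_apply_ne hij]; norm_num
  have hhe : ⟪h, e⟫ = -1 := by
    rw [hh, he, inner_coordGrad_sub, b.coord_apply_eq, b.coord_apply_ne hij.symm]; norm_num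
  have hke (k : ι) (hki : k ≠ i) (hkj : k ≠ j) : ⟪coordGrad b k, e⟫ = 0 := by
    rw [he, inner_coordGrad_sub, b.coord_apply_ne hki, b.coord_apply_ne hkj]; norm_num
  have hsf : SigmaFinite σ := sigmaFinite_hyperplaneMeasure hg0 _
  have hKc : IsCompact K := isCompact_convexHull_range b
  have hf' : Continuous fun x => fderiv ℝ f x e :=
    (hf.continuous_fderiv one_ne_zero).clm_apply continuous_const
  set F : Vec d → ℝ := K.indicator fun x => fderiv ℝ f x e with hF
  have hFint : Integrable F volume :=
    (hf'.continuousOn.integrableOn_compact hKc).integrable_indicator hKc.measurableSet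
  set φ : Vec d × ℝ → Vec d := fun q => q.1 + q.2 • e with hφ
  have hφm : Measurable φ := by fun_prop
  have hvol := volume_eq_hyperplane_prod (show ⟪g, e⟫ ≠ 0 by rw [hge]; norm_num) (-(b.coord i 0))
  rw [hge, abs_one] at hvol
  have hpos : 0 < 1 / ‖g‖ := by have := norm_pos_iff.2 hg0; positivity
  have hmap : Integrable F ((σ.prod volume).map φ) := by
    rw [hvol] at hFint
    exact (integrable_smul_measure (by simpa using hpos) ENNReal.ofReal_ne_top).1 hFint
  have hprod : Integrable (fun q => F (φ q)) (σ.prod volume) := hmap.comp_measurable hφm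
  set π : Vec d → Vec d := fun y => y + (⟪h, y⟫ - -(b.coord j 0)) • e with hπ
  have hπ' (y : Vec d) : π y = y + b.coord j y • e := by
    change y + (⟪h, y⟫ - -(b.coord j 0)) • e = _
    rw [coord_eq_inner b j y, sub_neg_eq_add]
  have hπm : Measurable π := by fun_prop
  have hπc : Continuous π := by fun_prop
  -- Moving along `e` by `b.coord j y` transfers the whole weight of vertex `j` to vertex `i` and
  -- leaves the other coordinates alone.
  have hface (y : Vec d) (hy : b.coord i y = 0) :
      y ∈ oppositeFace b i ↔ π y ∈ oppositeFace b j := by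
    rw [hπ']
    simp only [oppositeFace, Set.mem_ofPred_eq, coord_add_smul]
    rw [hhe]
    have : ∀ k, k ≠ i → k ≠ j → b.coord k y + b.coord j y * ⟪coordGrad b k, e⟫ = b.coord k y := by
      intro k hki hkj
      rw [hke k hki hkj, mul_zero, add_zero]
    constructor
    · rintro ⟨h1, h2⟩
      refine ⟨by ring, fun k => ?_⟩
      by_cases hki : k = i
      · subst hki; rw [← hg, hge, h1]; simpa using h2 j
      by_cases hkj : k = j
      · subst hkj; rw [← hh, hhe]; simp
      rw [this k hki hkj]; exact h2 k
    · rintro ⟨h1, h2⟩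
      refine ⟨hy, fun k => ?_⟩
      by_cases hki : k = i
      · rw [hki, hy]
      by_cases hkj : k = j
      · have := h2 i
        rw [← hg, hge, hy] at this
        rw [hkj]; linarith
      rw [← this k hki hkj]; exact h2 k
  have hinner (y : Vec d) (hy : b.coord i y = 0) :
      ∫ t, F (φ (y, t)) = (oppositeFace b i).indicator (fun y => f (π y) - f y) y := by
    have hmem (t : ℝ) (ht : 0 ≤ t) (ht' : t ≤ b.coord j y) (hyf : y ∈ oppositeFace b i) :
        y + t • e ∈ K := by
      rw [hK, convexHull_range_eq]
      intro k
      rw [coord_add_smul]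
      by_cases hki : k = i
      · subst hki; rw [← hg, hge, hy]; simpa using ht
      by_cases hkj : k = j
      · subst hkj; rw [← hh, hhe]; linarith
      rw [hke k hki hkj]; simpa using hyf.2 k
    have hmem' (t : ℝ) (hK' : y + t • e ∈ K) :
        0 ≤ t ∧ t ≤ b.coord j y ∧ y ∈ oppositeFace b i := by
      rw [hK, convexHull_range_eq] at hK'
      simp only [Set.mem_ofPred_eq, coord_add_smul] at hK'
      have hi := hK' i
      have hj := hK' j
      rw [← hg, hge, hy] at hi
      rw [← hh, hhe] at hj
      refine ⟨by linarith, by linarith, hy, fun k => ?_⟩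
      by_cases hki : k = i
      · rw [hki, hy]
      by_cases hkj : k = j
      · rw [hkj]; linarith
      have := hK' k
      rw [hke k hki hkj] at this
      linarith
    by_cases hyf : y ∈ oppositeFace b i
    · rw [Set.indicator_of_mem hyf]
      have hle : 0 ≤ b.coord j y := hyf.2 j
      have h1 : (fun t => F (φ (y, t))) =
          (Set.Icc 0 (b.coord j y)).indicator fun t => fderiv ℝ f (y + t • e) e := by
        funext t
        by_cases ht : t ∈ Set.Icc 0 (b.coord j y)
        · rw [Set.indicator_of_mem ht, hF, Set.indicator_of_mem (hmem t ht.1 ht.2 hyf)]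
        · rw [Set.indicator_of_notMem ht, hF, Set.indicator_of_notMem]
          intro hc
          exact ht ⟨(hmem' t hc).1, (hmem' t hc).2.1⟩
      rw [h1, integral_indicator measurableSet_Icc, integral_Icc_eq_integral_Ioc,
        ← intervalIntegral.integral_of_le hle,
        intervalIntegral.integral_eq_sub_of_hasDerivAt (f := fun t => f (y + t • e))]
      · rw [hπ', zero_smul, add_zero]
      · intro t _
        have h2 := (hf.differentiable one_ne_zero (y + t • e)).hasFDerivAt
        have h3 : HasDerivAt (fun t : ℝ => y + t • e) e t := by
          simpa using ((hasDerivAt_id t).smul_const e).const_add y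
        exact h2.comp_hasDerivAt t h3
      · exact (hf'.comp (by fun_prop)).intervalIntegrable _ _
    · rw [Set.indicator_of_notMem hyf]
      have h1 : (fun t => F (φ (y, t))) = fun _ => 0 := by
        funext t
        rw [hF, Set.indicator_of_notMem]
        intro hc
        exact hyf (hmem' t hc).2.2
      rw [h1, integral_zero]
  have hae : ∀ᵐ y ∂σ, b.coord i y = 0 := by
    filter_upwards [ae_restrict_mem (measurableSet_hyperplane g (-(b.coord i 0)))] with y hy
    exact (mem_hyperplane_iff b i y).1 hy
  have hmi := (isCompact_oppositeFace b i).measurableSet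
  have hmj := (isCompact_oppositeFace b j).measurableSet
  have hproj := hyperplaneMeasure_map_projection (c := -(b.coord i 0)) (k := -(b.coord j 0)) hge hhe
  have step1 : ∫ x in K, fderiv ℝ f x e =
      ‖g‖⁻¹ * ∫ y in oppositeFace b i, (f (π y) - f y) ∂μHE[d - 1] := by
    have h1 : ∫ x in K, fderiv ℝ f x e = ∫ x, F x :=
      (integral_indicator hKc.measurableSet).symm
    rw [h1, hvol, integral_smul_measure, integral_map hφm.aemeasurable hmap.1, integral_prod _ hprod,
      integral_congr_ae (hae.mono fun y hy => hinner y hy), integral_indicator hmi,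
      hyperplaneMeasure_restrict_oppositeFace, ENNReal.toReal_ofReal hpos.le, one_div, smul_eq_mul]
  -- Change of variables under the oblique projection `π` from one face to the other.
  have step2 : ‖g‖⁻¹ * ∫ y in oppositeFace b i, f (π y) ∂μHE[d - 1] =
      ‖h‖⁻¹ * ∫ x in oppositeFace b j, f x ∂μHE[d - 1] := by
    rw [← hyperplaneMeasure_restrict_oppositeFace, ← hyperplaneMeasure_restrict_oppositeFace,
      ← integral_indicator hmi, ← integral_indicator hmj]
    have h1 : ∫ y, (oppositeFace b i).indicator (fun y => f (π y)) y ∂σ =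
        ∫ y, (oppositeFace b j).indicator f (π y) ∂σ := by
      refine integral_congr_ae (hae.mono fun y hy => ?_)
      by_cases hyf : y ∈ oppositeFace b i
      · simp only [Set.indicator_of_mem hyf, Set.indicator_of_mem ((hface y hy).1 hyf)]
      · have : π y ∉ oppositeFace b j := fun hc => hyf ((hface y hy).2 hc)
        simp only [Set.indicator_of_notMem hyf, Set.indicator_of_notMem this]
    rw [h1, ← integral_map (f := (oppositeFace b j).indicator f) hπm.aemeasurable
      ((hf.continuous.measurable.indicator hmj).aestronglyMeasurable)]
    have h2 := congrArg (fun μ => ∫ x, (oppositeFace b j).indicator f x ∂μ) hproj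
    simp only [integral_smul_measure, smul_eq_mul] at h2
    rw [ENNReal.toReal_ofReal (by positivity), ENNReal.toReal_ofReal (by positivity), one_div,
      one_div] at h2
    exact h2.symm
  have hfπ : IntegrableOn (fun y => f (π y)) (oppositeFace b i) μHE[d - 1] :=
    integrableOn_oppositeFace b i (hf.continuous.comp hπc).continuousOn
  rw [step1, integral_sub hfπ (integrableOn_oppositeFace b i hf.continuous.continuousOn), mul_sub, step2]

theorem sum_inner_coordGrad (v : Vec d) : ∑ i, ⟪coordGrad b i, v⟫ = 0 := by
  have h1 := b.sum_coord_apply_eq_one v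
  have h2 := b.sum_coord_apply_eq_one 0
  simp_rw [fun i => coord_eq_inner b i v, Finset.sum_add_distrib] at h1
  linarith

theorem eq_sum_inner_coordGrad_smul (j : ι) (v : Vec d) :
    v = ∑ i, ⟪coordGrad b i, v⟫ • (b i - b j) := by
  have h1 := b.linear_combination_coord_eq_self v
  have h2 := b.linear_combination_coord_eq_self 0
  simp_rw [smul_sub, Finset.sum_sub_distrib, ← Finset.sum_smul, sum_inner_coordGrad, zero_smul,
    sub_zero]
  simp_rw [fun i => coord_eq_inner b i v, add_smul, Finset.sum_add_distrib, h2, add_zero] at h1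
  exact h1.symm

/-- The gradients `coordGrad b i` and the edges `b i - b j` form dual systems, so both sides are the
trace of `L`. The divergence thereby becomes a sum of derivatives along edges. -/
theorem sum_apply_single_eq (j : ι) (L : Vec d →L[ℝ] Vec d) :
    ∑ k, L (EuclideanSpace.single k 1) k = ∑ i, ⟪coordGrad b i, L (b i - b j)⟫ := by
  have h1 (k : Fin d) : L (EuclideanSpace.single k 1) k =
      ∑ i, ⟪coordGrad b i, EuclideanSpace.single k (1 : ℝ)⟫ *
        ⟪EuclideanSpace.single k (1 : ℝ), L (b i - b j)⟫ := by
    conv_lhs => rw [eq_sum_inner_coordGrad_smul b j (EuclideanSpace.single k 1), map_sum]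
    rw [WithLp.ofLp_sum, Finset.sum_apply]
    refine Finset.sum_congr rfl fun i _ => ?_
    rw [map_smul, PiLp.smul_apply, smul_eq_mul]
    simp [EuclideanSpace.inner_single_left]
  simp_rw [h1]
  rw [Finset.sum_comm]
  refine Finset.sum_congr rfl fun i _ => ?_
  have := (EuclideanSpace.basisFun (Fin d) ℝ).sum_inner_mul_inner (coordGrad b i) (L (b i - b j))
  simpa only [EuclideanSpace.basisFun_apply] using this

theorem divg_eq_sum (w : Vec d → Vec d) (x : Vec d) :
    divg w x = ∑ k, fderiv ℝ w x (EuclideanSpace.single k 1) k := by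
  simp [divg, grad, Matrix.trace]

/-- The divergence theorem on a simplex. -/
theorem setIntegral_divg_convexHull_range [Nontrivial ι] {w : Vec d → Vec d}
    (hw : ContDiff ℝ 1 w) :
    ∫ x in convexHull ℝ (Set.range b), divg w x =
      -∑ i, ∫ x in oppositeFace b i, ⟪‖coordGrad b i‖⁻¹ • coordGrad b i, w x⟫ ∂μHE[d - 1] := by
  classical
  obtain ⟨j⟩ := b.nonempty
  have hcd (i : ι) : ContDiff ℝ 1 fun x => ⟪coordGrad b i, w x⟫ := contDiff_const.inner ℝ hw
  have hfd (i : ι) (x v : Vec d) :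
      ⟪coordGrad b i, fderiv ℝ w x v⟫ = fderiv ℝ (fun x => ⟪coordGrad b i, w x⟫) x v := by
    have h := ((innerSL ℝ (coordGrad b i)).hasFDerivAt.comp x
      (hw.differentiable one_ne_zero x).hasFDerivAt).fderiv
    change _ = fderiv ℝ ((innerSL ℝ (coordGrad b i)) ∘ w) x v
    rw [h]
    simp
  have hint (i : ι) : IntegrableOn
      (fun x => fderiv ℝ (fun x => ⟪coordGrad b i, w x⟫) x (b i - b j))
      (convexHull ℝ (Set.range b)) volume :=
    (((hcd i).continuous_fderiv one_ne_zero).clm_apply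
      continuous_const).continuousOn.integrableOn_compact (isCompact_convexHull_range b)
  simp_rw [divg_eq_sum, sum_apply_single_eq b j, hfd]
  rw [integral_finsetSum _ fun i _ => hint i]
  simp_rw [real_inner_smul_left, integral_const_mul]
  have hfi (i k : ι) : IntegrableOn (fun x => ⟪coordGrad b k, w x⟫) (oppositeFace b i) μHE[d - 1] :=
    integrableOn_oppositeFace b i (hcd k).continuous.continuousOn
  have hterm (i : ι) : ∫ x in convexHull ℝ (Set.range b),
      fderiv ℝ (fun x => ⟪coordGrad b i, w x⟫) x (b i - b j) =
      ‖coordGrad b j‖⁻¹ * (∫ x in oppositeFace b j, ⟪coordGrad b i, w x⟫ ∂μHE[d - 1]) -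
        ‖coordGrad b i‖⁻¹ * ∫ x in oppositeFace b i, ⟪coordGrad b i, w x⟫ ∂μHE[d - 1] := by
    rcases eq_or_ne i j with rfl | hij
    · simp
    · exact setIntegral_fderiv_edge b hij (hcd i)
  simp_rw [hterm]
  -- The contributions of the face opposite the base vertex `j` assemble into the sum of all the
  -- gradients, which is zero.
  rw [Finset.sum_sub_distrib, ← Finset.mul_sum, ← integral_finsetSum _ fun i _ => hfi j i]
  simp_rw [sum_inner_coordGrad]
  simp

end Simplex

/-! ### Generic points of faces and transversal directions. -/

section Simplex

variable {d : ℕ} {ι : Type*} (b : AffineBasis ι ℝ (Vec d))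

theorem convexHull_image_compl_subset (i : ι) {x : Vec d}
    (hx : x ∈ convexHull ℝ (b '' {i}ᶜ)) : b.coord i x = 0 := by
  have hc : Convex ℝ {x | b.coord i x = 0} := by
    have : {x | b.coord i x = 0} = b.coord i ⁻¹' {0} := rfl
    rw [this]
    exact (convex_singleton (0 : ℝ)).affine_preimage _
  refine convexHull_min ?_ hc hx
  rintro _ ⟨j, hj, rfl⟩
  exact b.coord_apply_ne (Ne.symm hj)

variable [Fintype ι]

theorem coord_eq_sum {κ : Type*} (b' : AffineBasis κ ℝ (Vec d)) (k : κ) (x : Vec d) :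
    b'.coord k x = ∑ l, b.coord l x * b'.coord k (b l) := by
  have h1 := b.linear_combination_coord_eq_self x
  have h2 := b.sum_coord_apply_eq_one x
  rw [coord_eq_inner b' k x]
  simp_rw [fun l => coord_eq_inner b' k (b l), mul_add, Finset.sum_add_distrib, ← Finset.sum_mul, h2,
    one_mul]
  congr 1
  conv_lhs => rw [← h1]
  rw [inner_sum]
  simp_rw [real_inner_smul_right]

theorem convexHull_image_compl (i : ι) :
    convexHull ℝ (b '' {i}ᶜ) = oppositeFace b i := by
  classical
  refine Set.Subset.antisymm (fun x hx => ⟨convexHull_image_compl_subset b i hx, ?_⟩) ?_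
  · have := convexHull_mono (Set.image_subset_range b {i}ᶜ) hx
    rwa [convexHull_range_eq] at this
  · rintro x ⟨hx0, hx⟩
    have h1 := b.linear_combination_coord_eq_self x
    have h2 := b.sum_coord_apply_eq_one x
    rw [← Finset.add_sum_erase _ _ (Finset.mem_univ i), hx0] at h1 h2
    rw [zero_smul, zero_add] at h1
    rw [zero_add] at h2
    rw [← h1]
    refine (convex_convexHull ℝ _).sum_mem (fun k _ => hx k) h2 fun k hk => ?_
    exact subset_convexHull ℝ _ ⟨k, Finset.ne_of_mem_erase hk, rfl⟩

/-- The other coordinates stay positive by continuity, so only the sign of the `i`-th one decides.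
-/
theorem eventually_add_smul_mem_interior {i : ι} {x w : Vec d} (hx : b.coord i x = 0)
    (hpos : ∀ k, k ≠ i → 0 < b.coord k x) :
    ∀ᶠ δ in 𝓝 (0 : ℝ), 0 < δ * ⟪coordGrad b i, w⟫ →
      x + δ • w ∈ interior (convexHull ℝ (Set.range b)) := by
  have h : ∀ᶠ δ in 𝓝 (0 : ℝ), ∀ k, k ≠ i → 0 < b.coord k (x + δ • w) := by
    rw [eventually_all]
    intro k
    by_cases hk : k = i
    · exact Eventually.of_forall fun δ h => absurd hk h
    have hc : Continuous fun δ : ℝ => b.coord k (x + δ • w) :=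
      (continuous_coord b k).comp (by fun_prop)
    have := hc.tendsto 0
    simp only [zero_smul, add_zero] at this
    exact (this.eventually (lt_mem_nhds (hpos k hk))).mono fun δ h _ => h
  filter_upwards [h] with δ hδ hδi
  rw [b.interior_convexHull]
  intro k
  by_cases hk : k = i
  · rw [hk, coord_add_smul, hx, zero_add]; exact hδi
  · exact hδ k hk

/-- The exceptional points lie on the hyperplanes where a further coordinate vanishes. Such a
hyperplane is Lebesgue null and invariant under a direction transversal to the face, hence null for
the surface measure. -/
theorem ae_oppositeFace_coord_pos (hcard : 3 ≤ Fintype.card ι) (i : ι) :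
    ∀ᵐ x ∂(μHE[d - 1].restrict (oppositeFace b i)), ∀ k, k ≠ i → 0 < b.coord k x := by
  have : Nontrivial ι := Fintype.one_lt_card_iff_nontrivial.1 (by omega)
  rw [← hyperplaneMeasure_restrict_oppositeFace, ae_all_iff]
  intro k
  by_cases hk : k = i
  · exact Eventually.of_forall fun x h => absurd hk h
  -- A third vertex supplies the direction `b i - b l`, which fixes coordinate `k` but changes
  -- coordinate `i`.
  obtain ⟨l, hlk, hli⟩ : ∃ l, l ≠ k ∧ l ≠ i := by
    classical
    by_contra! h
    have : (Finset.univ : Finset ι) ⊆ {k, i} := by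
      intro l _
      by_cases hl : l = k
      · simp [hl]
      · simp [h l hl]
    have h1 := Finset.card_le_card this
    have h2 := Finset.card_le_two (a := k) (b := i)
    rw [Finset.card_univ] at h1
    omega
  have h1 : hyperplaneMeasure (coordGrad b i) (-(b.coord i 0)) {x | b.coord k x = 0} = 0 := by
    refine hyperplaneMeasure_eq_zero (e := b i - b l) ?_ _
      (isClosed_eq (continuous_coord b k) continuous_const).measurableSet ?_ ?_
    · rw [inner_coordGrad_sub, b.coord_apply_eq, b.coord_apply_ne hli.symm]; norm_num
    · have h2 : {x | b.coord k x = 0} ⊆ frontier {x | 0 ≤ b.coord k x} := by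
        intro x hx
        refine ⟨subset_closure (le_of_eq (Eq.symm hx)), fun hint => ?_⟩
        have hev : ∀ᶠ δ in 𝓝 (0 : ℝ), x + δ • (b k - b i) ∈ {x | 0 ≤ b.coord k x} := by
          have hc : Continuous fun δ : ℝ => x + δ • (b k - b i) := by fun_prop
          have := hc.tendsto 0
          simp only [zero_smul, add_zero] at this
          exact this.eventually (mem_interior_iff_mem_nhds.1 hint)
        obtain ⟨δ, hδ, hδ0⟩ := ((hev.filter_mono nhdsWithin_le_nhds).and
          (self_mem_nhdsWithin : Set.Iio (0 : ℝ) ∈ 𝓝[<] 0)).exists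
        have hδ1 : 0 ≤ b.coord k (x + δ • (b k - b i)) := hδ
        rw [coord_add_smul, show b.coord k x = 0 from hx, inner_coordGrad_sub, b.coord_apply_eq,
          b.coord_apply_ne hk] at hδ1
        have : δ < 0 := hδ0
        linarith
      refine measure_mono_null h2 (Convex.addHaar_frontier _ ?_)
      exact (convex_Ici (0 : ℝ)).affine_preimage (b.coord k)
    · intro x hx t
      rw [Set.mem_ofPred_eq, coord_add_smul, inner_coordGrad_sub, b.coord_apply_ne hk,
        b.coord_apply_ne hlk.symm, show b.coord k x = 0 from hx]
      ring
  have h2 : ∀ᵐ x ∂(hyperplaneMeasure (coordGrad b i) (-(b.coord i 0))).restrict (oppositeFace b i),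
      b.coord k x ≠ 0 := ae_restrict_of_ae (by rw [ae_iff]; simpa using h1)
  filter_upwards [h2, ae_restrict_mem (isCompact_oppositeFace b i).measurableSet] with x hx hxf _
  exact lt_of_le_of_ne (hxf.2 k) (Ne.symm hx)

/-- An interior point is slid parallel to the edge until its `i`-th weight has passed to `j`. -/
theorem exists_oppositeFace_coord_pos {i j : ι} (hij : i ≠ j) :
    ∃ x, b.coord i x = 0 ∧ ∀ k, k ≠ i → 0 < b.coord k x := by
  obtain ⟨c, hc⟩ : ∃ c, ∀ k, 0 < b.coord k c := by
    have := b.centroid_mem_interior_convexHull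
    rw [b.interior_convexHull] at this
    exact ⟨_, this⟩
  refine ⟨c + (-(b.coord i c)) • (b i - b j), ?_, fun k hk => ?_⟩
  · rw [coord_add_smul, inner_coordGrad_sub, b.coord_apply_eq, b.coord_apply_ne hij]; ring
  · rw [coord_add_smul, inner_coordGrad_sub, b.coord_apply_ne hk]
    by_cases hkj : k = j
    · rw [hkj, b.coord_apply_eq]
      linarith [hc i, hc j]
    · rw [b.coord_apply_ne hkj]
      linarith [hc k]

/-- A vector orthogonal to a face of a simplex is a multiple of the gradient of the barycentric
coordinate that vanishes on this face. -/
theorem eq_smul_coordGrad {i j : ι} {n : Vec d}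
    (hn : ∀ k, k ≠ i → ⟪n, b k - b j⟫ = 0) : n = ⟪n, b i - b j⟫ • coordGrad b i := by
  refine ext_inner_right ℝ fun v => ?_
  conv_lhs => rw [eq_sum_inner_coordGrad_smul b j v, inner_sum]
  rw [Finset.sum_eq_single i]
  · rw [real_inner_smul_right, real_inner_smul_left, mul_comm]
  · intro k _ hk
    rw [real_inner_smul_right, hn k hk, mul_zero]
  · simp

end Simplex

/-! ### Combinatorics and geometry of faces in a conforming mesh. -/

namespace Mesh

variable {d : ℕ} {D : Set (Vec d)} (M : Mesh d D)

/-- The vertices of an element as an affine basis. -/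
noncomputable def basis {s : Finset (Vec d)} (hs : s ∈ M.cells) : AffineBasis s ℝ (Vec d) where
  toFun := (↑)
  ind' := M.affineIndependent s hs
  tot' := by
    rw [(M.affineIndependent s hs).affineSpan_eq_top_iff_card_eq_finrank_add_one,
      Fintype.card_coe, M.card_eq s hs, finrank_euclideanSpace_fin]

@[simp]
theorem basis_apply {s : Finset (Vec d)} (hs : s ∈ M.cells) (a : s) : M.basis hs a = a := rfl

theorem range_basis {s : Finset (Vec d)} (hs : s ∈ M.cells) :
    Set.range (M.basis hs) = (s : Set (Vec d)) := by
  ext x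
  simp

theorem image_basis_compl [DecidableEq (Vec d)] {s : Finset (Vec d)} (hs : s ∈ M.cells) (a : s) :
    M.basis hs '' {a}ᶜ = (s.erase a : Set (Vec d)) := by
  ext x
  simp only [Set.mem_image, Set.mem_compl_iff, Set.mem_singleton_iff, Finset.coe_erase,
    Set.mem_sdiff, Finset.mem_coe]
  constructor
  · rintro ⟨k, hk, rfl⟩
    exact ⟨k.2, fun h => hk (Subtype.ext h)⟩
  · rintro ⟨h1, h2⟩
    exact ⟨⟨x, h1⟩, fun h => h2 (congrArg Subtype.val h), rfl⟩

theorem convexHull_erase [DecidableEq (Vec d)] {s : Finset (Vec d)} (hs : s ∈ M.cells) (a : s) :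
    convexHull ℝ (s.erase a : Set (Vec d)) = oppositeFace (M.basis hs) a := by
  rw [← M.image_basis_compl hs a, convexHull_image_compl]

theorem isCompact_cell (s : Finset (Vec d)) : IsCompact (convexHull ℝ (s : Set (Vec d))) :=
  s.finite_toSet.isCompact_convexHull (𝕜 := ℝ)

theorem mem_interior_cell_iff {s : Finset (Vec d)} (hs : s ∈ M.cells) (x : Vec d) :
    x ∈ interior (convexHull ℝ (s : Set (Vec d))) ↔ ∀ k, 0 < (M.basis hs).coord k x := by
  rw [← M.range_basis hs, (M.basis hs).interior_convexHull]
  rfl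

theorem mem_cell_iff {s : Finset (Vec d)} (hs : s ∈ M.cells) (x : Vec d) :
    x ∈ convexHull ℝ (s : Set (Vec d)) ↔ ∀ k, 0 ≤ (M.basis hs).coord k x := by
  rw [← M.range_basis hs, convexHull_range_eq]
  rfl

theorem cell_subset_closure {s : Finset (Vec d)} (hs : s ∈ M.cells) :
    convexHull ℝ (s : Set (Vec d)) ⊆ closure D := by
  rw [M.closure_eq]
  exact Set.subset_biUnion_of_mem (u := fun s : Finset (Vec d) => convexHull ℝ (s : Set (Vec d))) hs

theorem closure_interior_cell {s : Finset (Vec d)} (hs : s ∈ M.cells) :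
    closure (interior (convexHull ℝ (s : Set (Vec d)))) = convexHull ℝ (s : Set (Vec d)) := by
  have hne : (interior (convexHull ℝ (s : Set (Vec d)))).Nonempty := by
    have := (M.basis hs).centroid_mem_interior_convexHull
    rw [M.range_basis hs] at this
    exact ⟨_, this⟩
  rw [(convex_convexHull ℝ _).closure_interior_eq_closure_of_nonempty_interior hne]
  exact (isCompact_cell s).isClosed.closure_eq

/-- In a conforming mesh, a barycentric coordinate of an element vanishes on every other element
that does not contain the corresponding vertex. -/
theorem coord_eq_zero_of_mem {s t : Finset (Vec d)} (hs : s ∈ M.cells) (ht : t ∈ M.cells)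
    {k : s} (hk : (k : Vec d) ∉ t) {x : Vec d} (hxs : x ∈ convexHull ℝ (s : Set (Vec d)))
    (hxt : x ∈ convexHull ℝ (t : Set (Vec d))) : (M.basis hs).coord k x = 0 := by
  classical
  have hx : x ∈ convexHull ℝ ((s : Set (Vec d)) ∩ (t : Set (Vec d))) := by
    rw [← M.conforming s hs t ht]; exact ⟨hxs, hxt⟩
  refine convexHull_image_compl_subset (M.basis hs) k (convexHull_mono ?_ hx)
  rintro y ⟨h1, h2⟩
  exact ⟨⟨y, h1⟩, fun h => hk (by rw [← Set.mem_singleton_iff.1 h]; exact h2), rfl⟩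

theorem exists_mem_notMem {s t : Finset (Vec d)} (hs : s ∈ M.cells) (ht : t ∈ M.cells)
    (hst : s ≠ t) : ∃ k ∈ s, k ∉ t := by
  by_contra! h
  exact hst (Finset.eq_of_subset_of_card_le h (by rw [M.card_eq s hs, M.card_eq t ht]))

theorem disjoint_interior {s t : Finset (Vec d)} (hs : s ∈ M.cells) (ht : t ∈ M.cells)
    (hst : s ≠ t) : Disjoint (interior (convexHull ℝ (s : Set (Vec d))))
      (interior (convexHull ℝ (t : Set (Vec d)))) := by
  rw [Set.disjoint_left]
  intro x hxs hxt
  obtain ⟨k, hks, hkt⟩ := M.exists_mem_notMem hs ht hst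
  have h1 := (M.mem_interior_cell_iff hs x).1 hxs ⟨k, hks⟩
  have h2 := M.coord_eq_zero_of_mem hs ht (k := ⟨k, hks⟩) hkt (_root_.interior_subset hxs)
    (_root_.interior_subset hxt)
  linarith

theorem mem_internalFaces_iff [DecidableEq (Vec d)] {f : Finset (Vec d)} :
    f ∈ M.internalFaces ↔ ∃ s ∈ M.cells, ∃ t ∈ M.cells, s ≠ t ∧ s ∩ t = f ∧ f.card = d := by
  classical
  simp only [internalFaces, Finset.mem_filter, Finset.mem_image, Finset.mem_offDiag, Prod.exists]
  constructor
  · rintro ⟨⟨s, t, ⟨hs, ht, hst⟩, h⟩, hc⟩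
    exact ⟨s, hs, t, ht, hst, by convert h, hc⟩
  · rintro ⟨s, hs, t, ht, hst, h, hc⟩
    exact ⟨⟨s, t, ⟨hs, ht, hst⟩, by convert h⟩, hc⟩

/-- The points of a face that is not internal, and that are not on one of its own faces, belong to
the boundary of the domain. -/
theorem mem_frontier_of_notMem_internalFaces [DecidableEq (Vec d)] (hD : IsOpen D)
    {s : Finset (Vec d)}
    (hs : s ∈ M.cells) (a : s) (hf : s.erase a ∉ M.internalFaces) {x : Vec d}
    (hx : (M.basis hs).coord a x = 0) (hpos : ∀ k, k ≠ a → 0 < (M.basis hs).coord k x) :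
    x ∈ frontier D := by
  have hxs : x ∈ convexHull ℝ (s : Set (Vec d)) := by
    rw [M.mem_cell_iff hs]
    intro k
    by_cases hk : k = a
    · rw [hk, hx]
    · exact (hpos k hk).le
  -- If another element `t` contained `x`, conformity and the positive coordinates would force every
  -- vertex except `a` into `t`, which would make the face internal.
  have hnot (t : Finset (Vec d)) (ht : t ∈ M.cells.erase s) :
      x ∉ convexHull ℝ (t : Set (Vec d)) := by
    intro hxt
    obtain ⟨hts, ht⟩ := Finset.mem_erase.1 ht
    refine hf ((M.mem_internalFaces_iff).2 ⟨s, hs, t, ht, hts.symm, ?_, ?_⟩)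
    · have hsub : s.erase a ⊆ s ∩ t := by
        intro k hk
        obtain ⟨hka, hks⟩ := Finset.mem_erase.1 hk
        refine Finset.mem_inter.2 ⟨hks, ?_⟩
        by_contra hkt
        have h1 := M.coord_eq_zero_of_mem hs ht (k := ⟨k, hks⟩) hkt hxs hxt
        have h2 := hpos ⟨k, hks⟩ fun h => hka (congrArg Subtype.val h)
        linarith
      refine (Finset.eq_of_subset_of_card_le hsub ?_).symm
      rw [Finset.card_erase_of_mem a.2]
      obtain ⟨k, hks, hkt⟩ := M.exists_mem_notMem hs ht hts.symm
      have : s ∩ t ⊆ s.erase k := by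
        intro l hl
        obtain ⟨hls, hlt⟩ := Finset.mem_inter.1 hl
        exact Finset.mem_erase.2 ⟨fun h => hkt (h ▸ hlt), hls⟩
      have := Finset.card_le_card this
      rwa [Finset.card_erase_of_mem hks] at this
    · rw [Finset.card_erase_of_mem a.2, M.card_eq s hs]; rfl
  rw [hD.frontier_eq]
  refine ⟨M.cell_subset_closure hs hxs, fun hxD => ?_⟩
  have hclosed : IsClosed (⋃ t ∈ M.cells.erase s, convexHull ℝ (t : Set (Vec d))) :=
    (M.cells.erase s).finite_toSet.isClosed_biUnion fun t _ => (isCompact_cell t).isClosed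
  have hxn : x ∈ (⋃ t ∈ M.cells.erase s, convexHull ℝ (t : Set (Vec d)))ᶜ := by
    simp only [Set.mem_compl_iff, Set.mem_iUnion, not_exists]
    exact hnot
  -- Were `x` in `D`, then `s` alone would cover a neighbourhood of `x`, although coordinate `a`
  -- vanishes at `x`.
  have hint : x ∈ interior (convexHull ℝ (s : Set (Vec d))) := by
    rw [mem_interior]
    refine ⟨D ∩ (⋃ t ∈ M.cells.erase s, convexHull ℝ (t : Set (Vec d)))ᶜ, ?_,
      hD.inter hclosed.isOpen_compl, hxD, hxn⟩
    rintro y ⟨hyD, hyn⟩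
    have hy : y ∈ closure D := subset_closure hyD
    rw [M.closure_eq] at hy
    simp only [Set.mem_iUnion, exists_prop] at hy
    obtain ⟨t, ht, hyt⟩ := hy
    by_cases hts : t = s
    · rwa [hts] at hyt
    · exact absurd (Set.mem_biUnion (Finset.mem_erase.2 ⟨hts, ht⟩ : t ∈ _) hyt) hyn
  have := (M.mem_interior_cell_iff hs x).1 hint a
  linarith

open Classical in
/-- The unit inner normal of the face of the element `s` that is opposite to the vertex `a`. -/
noncomputable def innerNormal (s : Finset (Vec d)) (a : Vec d) : Vec d :=
  -- The default value makes the normal a function of `s` and `a` alone, so that sums over pairs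
  -- carry no membership proofs.
  if h : s ∈ M.cells ∧ a ∈ s then
    ‖coordGrad (M.basis h.1) ⟨a, h.2⟩‖⁻¹ • coordGrad (M.basis h.1) ⟨a, h.2⟩ else 0

theorem innerNormal_eq {s : Finset (Vec d)} (hs : s ∈ M.cells) (a : s) :
    M.innerNormal s a = ‖coordGrad (M.basis hs) a‖⁻¹ • coordGrad (M.basis hs) a := by
  rw [innerNormal, dif_pos ⟨hs, a.2⟩]

theorem nontrivial_cell (hd : 1 ≤ d) {s : Finset (Vec d)} (hs : s ∈ M.cells) : Nontrivial s := by
  rw [← Fintype.one_lt_card_iff_nontrivial, Fintype.card_coe, M.card_eq s hs]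
  omega

/-- A unit vector orthogonal to a face of an element is one of the two unit normals. -/
theorem innerNormal_eq_or_eq_neg [DecidableEq (Vec d)] (hd : 1 ≤ d) {s : Finset (Vec d)}
    (hs : s ∈ M.cells) (a : s) {n : Vec d} (hn1 : ‖n‖ = 1)
    (hn : ∀ x ∈ s.erase a, ∀ y ∈ s.erase a, ⟪x - y, n⟫ = 0) :
    M.innerNormal s a = n ∨ M.innerNormal s a = -n := by
  have := M.nontrivial_cell hd hs
  obtain ⟨j, hj⟩ := exists_ne a
  have hmem (k : s) (hk : k ≠ a) : (k : Vec d) ∈ s.erase a :=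
    Finset.mem_erase.2 ⟨fun h => hk (Subtype.ext h), k.2⟩
  have h := eq_smul_coordGrad (M.basis hs) (i := a) (j := j) (n := n) fun k hk => by
    rw [real_inner_comm]
    exact hn _ (hmem k hk) _ (hmem j hj)
  set r := ⟪n, M.basis hs a - M.basis hs j⟫
  set g := coordGrad (M.basis hs) a with hg
  have hg0 : 0 < ‖g‖ := norm_pos_iff.2 (coordGrad_ne_zero _ _)
  have hr : |r| * ‖g‖ = 1 := by rw [← Real.norm_eq_abs, ← norm_smul, ← h, hn1]
  have hinv : ‖g‖⁻¹ = |r| := by field_simp; linarith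
  rw [M.innerNormal_eq hs, ← hg, hinv]
  rcases abs_choice r with h1 | h1 <;> rw [h1]
  · exact Or.inl h.symm
  · right
    rw [neg_smul, ← h]

/-- Two distinct elements that share a face lie on opposite sides of it. -/
theorem innerNormal_eq_neg_of_erase_eq [DecidableEq (Vec d)] (hd : 1 ≤ d) {s t : Finset (Vec d)}
    (hs : s ∈ M.cells) (ht : t ∈ M.cells) (hst : s ≠ t) (a : s) (b : t)
    (h : s.erase a = t.erase b) : M.innerNormal t b = -M.innerNormal s a := by
  have := M.nontrivial_cell hd hs
  have := M.nontrivial_cell hd ht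
  obtain ⟨j, hj⟩ := exists_ne a
  have hmem (k : s) (hk : k ≠ a) : ∃ k' : t, k' ≠ b ∧ (k' : Vec d) = k := by
    have : (k : Vec d) ∈ t.erase b := by
      rw [← h]; exact Finset.mem_erase.2 ⟨fun h => hk (Subtype.ext h), k.2⟩
    obtain ⟨h1, h2⟩ := Finset.mem_erase.1 this
    exact ⟨⟨k, h2⟩, fun h => h1 (congrArg Subtype.val h), rfl⟩
  have hmem' (k : t) (hk : k ≠ b) : ∃ k' : s, k' ≠ a ∧ (k' : Vec d) = k := by
    have : (k : Vec d) ∈ s.erase a := by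
      rw [h]; exact Finset.mem_erase.2 ⟨fun h => hk (Subtype.ext h), k.2⟩
    obtain ⟨h1, h2⟩ := Finset.mem_erase.1 this
    exact ⟨⟨k, h2⟩, fun h => h1 (congrArg Subtype.val h), rfl⟩
  have hat : (a : Vec d) ∉ t := by
    intro hat
    have hab : (a : Vec d) = b := by
      by_contra hab
      have : (a : Vec d) ∈ s.erase a := by rw [h]; exact Finset.mem_erase.2 ⟨hab, hat⟩
      exact Finset.notMem_erase _ _ this
    refine hst ?_
    rw [← Finset.insert_erase a.2, h, hab, Finset.insert_erase b.2]
  set gs := coordGrad (M.basis hs) a with hgs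
  set gt := coordGrad (M.basis ht) b with hgt
  have hvert (k : s) (hk : k ≠ a) : (M.basis ht).coord b k = 0 := by
    obtain ⟨k', hk', hkk⟩ := hmem k hk
    rw [← hkk]
    exact (M.basis ht).coord_apply_ne hk'.symm
  have hprop := eq_smul_coordGrad (M.basis hs) (i := a) (j := j) (n := gt) fun k hk => by
    rw [hgt, inner_coordGrad_sub, basis_apply, basis_apply, hvert k hk, hvert j hj, sub_zero]
  have hgt0 : gt ≠ 0 := coordGrad_ne_zero _ _
  have hgs0 : gs ≠ 0 := coordGrad_ne_zero _ _
  set r := ⟪gt, M.basis hs a - M.basis hs j⟫ with hr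
  have hr0 : r ≠ 0 := by
    intro h0
    rw [h0, zero_smul] at hprop
    exact hgt0 hprop
  -- If the two gradients pointed the same way, a small step along `gs` from a generic point of the
  -- common face would enter both interiors, which are disjoint.
  have hrneg : r < 0 := by
    by_contra hc
    have hrpos : 0 < r := lt_of_le_of_ne (not_lt.1 hc) (Ne.symm hr0)
    obtain ⟨x, hxa, hxpos⟩ := exists_oppositeFace_coord_pos (M.basis hs) hj.symm
    have hxb : (M.basis ht).coord b x = 0 := by
      rw [coord_eq_sum (M.basis hs)]
      refine Finset.sum_eq_zero fun k _ => ?_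
      by_cases hk : k = a
      · rw [hk, hxa, zero_mul]
      · rw [basis_apply, hvert k hk, mul_zero]
    have hxpos' (k : t) (hk : k ≠ b) : 0 < (M.basis ht).coord k x := by
      obtain ⟨k', hk', hkk⟩ := hmem' k hk
      have : (M.basis ht).coord k x = (M.basis hs).coord k' x := by
        rw [coord_eq_sum (M.basis hs), Finset.sum_eq_single k']
        · rw [basis_apply, hkk, ← M.basis_apply ht k, (M.basis ht).coord_apply_eq, mul_one]
        · intro l _ hl
          by_cases hla : l = a
          · rw [hla, hxa, zero_mul]
          · obtain ⟨l', hl', hll⟩ := hmem l hla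
            rw [basis_apply, ← hll, ← M.basis_apply ht l', (M.basis ht).coord_apply_ne, mul_zero]
            rintro rfl
            exact hl (Subtype.ext (hll.symm.trans hkk.symm))
        · simp
      rw [this]
      exact hxpos k' hk'
    have hgg : 0 < ⟪gs, gs⟫ := real_inner_self_pos.2 hgs0
    have e1 := eventually_add_smul_mem_interior (M.basis hs) (w := gs) hxa hxpos
    have e2 := eventually_add_smul_mem_interior (M.basis ht) (w := gs) hxb hxpos'
    rw [← hgs] at e1
    rw [← hgt] at e2
    obtain ⟨δ, ⟨h1, h2⟩, h3⟩ := (((e1.and e2).filter_mono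
      (nhdsWithin_le_nhds (s := Set.Ioi (0 : ℝ)))).and self_mem_nhdsWithin).exists
    have h3 : 0 < δ := h3
    specialize h1 (mul_pos h3 hgg)
    specialize h2 (by rw [hprop, real_inner_smul_left]; positivity)
    rw [M.range_basis] at h1 h2
    exact Set.disjoint_left.1 (M.disjoint_interior hs ht hst) h1 h2
  rw [M.innerNormal_eq hs, M.innerNormal_eq ht, ← hgs, ← hgt]
  rw [← hgs] at hprop
  rw [hprop, norm_smul, Real.norm_eq_abs, abs_of_neg hrneg, smul_smul, mul_inv, ← neg_smul]
  congr 1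
  have := norm_pos_iff.2 hgs0
  field_simp

/-- The elements `s` and `t` share the face `f`, the unit vector `n` points from `t` into `s`, and
no other element has the face `f`. -/
structure IsAdjacentPair [DecidableEq (Vec d)] (f : Finset (Vec d)) (n : Vec d)
    (s t : Finset (Vec d)) (a b : Vec d) : Prop where
  left_mem : s ∈ M.cells
  right_mem : t ∈ M.cells
  ne : s ≠ t
  left_vertex : a ∈ s
  right_vertex : b ∈ t
  left_erase : s.erase a = f
  right_erase : t.erase b = f
  left_normal : M.innerNormal s a = n
  right_normal : M.innerNormal t b = -n
  eq_or_eq : ∀ s' ∈ M.cells, ∀ a' ∈ s', s'.erase a' = f → s' = s ∧ a' = a ∨ s' = t ∧ a' = b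

/-- Elements sharing a face have opposite inner normals. Three of them would make a normal equal to
its own negative, which contradicts unit length. -/
theorem exists_isAdjacentPair [DecidableEq (Vec d)] (hd : 1 ≤ d) {ν : Finset (Vec d) → Vec d}
    (hν : M.IsUnitNormal ν) {f : Finset (Vec d)} (hf : f ∈ M.internalFaces) :
    ∃ s t a b, M.IsAdjacentPair f (ν f) s t a b := by
  obtain ⟨hν1, hν2⟩ := hν f hf
  obtain ⟨s, hs, t, ht, hst, hstf, hc⟩ := M.mem_internalFaces_iff.1 hf
  have key (s : Finset (Vec d)) (hs : s ∈ M.cells) (hfs : f ⊆ s) : ∃ a ∈ s, s.erase a = f := by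
    have h1 : (s \ f).card = 1 := by
      rw [Finset.card_sdiff_of_subset hfs, M.card_eq s hs, hc]; omega
    obtain ⟨a, ha⟩ := Finset.card_eq_one.1 h1
    have ha' : a ∈ s \ f := by rw [ha]; exact Finset.mem_singleton_self a
    refine ⟨a, (Finset.mem_sdiff.1 ha').1, ?_⟩
    rw [Finset.erase_eq, ← ha, Finset.sdiff_sdiff_eq_self hfs]
  obtain ⟨a, ha, hae⟩ := key s hs (hstf ▸ Finset.inter_subset_left)
  obtain ⟨b, hb, hbe⟩ := key t ht (hstf ▸ Finset.inter_subset_right)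
  have hneg := M.innerNormal_eq_neg_of_erase_eq hd hs ht hst ⟨a, ha⟩ ⟨b, hb⟩ (hae.trans hbe.symm)
  have heq : ∀ s' ∈ M.cells, ∀ a' ∈ s', s'.erase a' = f →
      s' = s ∧ a' = a ∨ s' = t ∧ a' = b := by
    intro s' hs' a' ha' h'
    have vert (s : Finset (Vec d)) (a : Vec d) (ha : a ∈ s) (hae : s.erase a = f) (hss : s' = s) :
        a' = a := by
      subst hss
      by_contra hne
      have : a' ∈ s'.erase a := Finset.mem_erase.2 ⟨hne, ha'⟩
      rw [hae, ← h'] at this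
      exact Finset.notMem_erase _ _ this
    by_cases h1 : s' = s
    · exact Or.inl ⟨h1, vert s a ha hae h1⟩
    by_cases h2 : s' = t
    · exact Or.inr ⟨h2, vert t b hb hbe h2⟩
    have n1 := M.innerNormal_eq_neg_of_erase_eq hd hs hs' (Ne.symm h1) ⟨a, ha⟩ ⟨a', ha'⟩
      (hae.trans h'.symm)
    have n2 := M.innerNormal_eq_neg_of_erase_eq hd ht hs' (Ne.symm h2) ⟨b, hb⟩ ⟨a', ha'⟩
      (hbe.trans h'.symm)
    rw [n1, hneg, neg_neg] at n2
    have h0 : M.innerNormal s a = 0 := by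
      have := neg_eq_iff_add_eq_zero.1 n2
      rw [← two_smul ℝ] at this
      exact (smul_eq_zero.1 this).resolve_left two_ne_zero
    rcases M.innerNormal_eq_or_eq_neg hd hs ⟨a, ha⟩ hν1 (by rw [hae]; exact hν2) with h | h
    · rw [h0] at h; rw [← h, norm_zero] at hν1; norm_num at hν1
    · rw [h0] at h
      rw [neg_eq_zero.1 h.symm, norm_zero] at hν1; norm_num at hν1
  -- The arbitrary orientation of `ν f` only decides which of the two elements is listed first.
  rcases M.innerNormal_eq_or_eq_neg hd hs ⟨a, ha⟩ hν1 (by rw [hae]; exact hν2) with h | h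
  · exact ⟨s, t, a, b, hs, ht, hst, ha, hb, hae, hbe, h, by rw [hneg, h], heq⟩
  · exact ⟨t, s, b, a, ht, hs, hst.symm, hb, ha, hbe, hae, by rw [hneg, h, neg_neg], h,
      fun s' hs' a' ha' h' => (heq s' hs' a' ha' h').symm⟩

end Mesh

end OldroydB

/-! ### Piecewise smooth functions and integration over the mesh. -/

open scoped ContDiff

namespace OldroydB

theorem contDiff_eval {d : ℕ} (P : MvPolynomial (Fin d) ℝ) :
    ContDiff ℝ ∞ fun x : Vec d => MvPolynomial.eval (fun i => x i) P := by
  induction P using MvPolynomial.induction_on with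
  | C a => simpa using contDiff_const
  | add p q hp hq => simpa using hp.add hq
  | mul_X p i hp => simpa using hp.mul (by fun_prop)

theorem fderiv_eval_single {d : ℕ} (P : MvPolynomial (Fin d) ℝ) (x : Vec d) (j : Fin d) :
    fderiv ℝ (fun x : Vec d => MvPolynomial.eval (fun i => x i) P) x (EuclideanSpace.single j 1) =
      MvPolynomial.eval (fun i => x i) (MvPolynomial.pderiv j P) := by
  have hdiff (Q : MvPolynomial (Fin d) ℝ) :
      DifferentiableAt ℝ (fun x : Vec d => MvPolynomial.eval (fun i => x i) Q) x :=
    (contDiff_eval Q).differentiable (by simp) x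
  induction P using MvPolynomial.induction_on with
  | C a => simp
  | add p q hp hq =>
    simp only [map_add]
    rw [fderiv_fun_add (hdiff p) (hdiff q), add_apply, hp, hq]
  | mul_X p i hp =>
    have hX : HasFDerivAt (fun x : Vec d => x i) (EuclideanSpace.proj i : Vec d →L[ℝ] ℝ) x :=
      (EuclideanSpace.proj i : Vec d →L[ℝ] ℝ).hasFDerivAt
    have hmul := ((hdiff p).hasFDerivAt.mul hX).fderiv
    simp only [map_mul, MvPolynomial.eval_X, Derivation.leibniz, MvPolynomial.pderiv_X, smul_eq_mul,
      map_add]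
    change fderiv ℝ ((fun x : Vec d => MvPolynomial.eval (fun i => x i) p) * fun x => x i) x _ = _
    rw [hmul]
    simp only [add_apply, smul_apply, hp, smul_eq_mul]
    by_cases hij : i = j
    · subst hij; simp
    · simp [hij]

theorem totalDegree_pderiv_le {d : ℕ} {P : MvPolynomial (Fin d) ℝ} {k : ℕ}
    (hP : P.totalDegree ≤ k + 1) (j : Fin d) : (MvPolynomial.pderiv j P).totalDegree ≤ k := by
  rw [MvPolynomial.totalDegree]
  refine Finset.sup_le fun m hm => ?_
  rw [MvPolynomial.mem_support_iff, MvPolynomial.coeff_pderiv] at hm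
  have h1 := MvPolynomial.le_totalDegree (MvPolynomial.mem_support_iff.2 (left_ne_zero_of_mul hm))
  rw [Finsupp.sum_add_index' (by simp) (by simp), Finsupp.sum_single_index rfl] at h1
  omega

namespace Mesh

variable {d : ℕ} {D : Set (Vec d)} (M : Mesh d D)

/-- In the interior of every element, `g` coincides with a smooth function. -/
def IsPiecewiseSmooth {F : Type*} [NormedAddCommGroup F] [NormedSpace ℝ F] (g : Vec d → F) :
    Prop :=
  ∀ s ∈ M.cells, ∃ G : Vec d → F, ContDiff ℝ ∞ G ∧
    ∀ x ∈ interior (convexHull ℝ (s : Set (Vec d))), g x = G x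

section Smooth

variable {M} {F F' F'' : Type*} [NormedAddCommGroup F] [NormedSpace ℝ F] [NormedAddCommGroup F']
  [NormedSpace ℝ F'] [NormedAddCommGroup F''] [NormedSpace ℝ F'']

theorem IsPiecewiseSmooth.comp₂ {g : Vec d → F} {h : Vec d → F'} (hg : M.IsPiecewiseSmooth g)
    (hh : M.IsPiecewiseSmooth h) {Φ : F × F' → F''} (hΦ : ContDiff ℝ ∞ Φ) :
    M.IsPiecewiseSmooth fun x => Φ (g x, h x) := by
  intro s hs
  obtain ⟨G, hG, hgG⟩ := hg s hs
  obtain ⟨H, hH, hhH⟩ := hh s hs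
  exact ⟨fun x => Φ (G x, H x), hΦ.comp (hG.prodMk hH), fun x hx => by simp only [hgG x hx, hhH x hx]⟩

theorem isPiecewiseSmooth_const (c : F) : M.IsPiecewiseSmooth fun _ => c :=
  fun _ _ => ⟨fun _ => c, contDiff_const, fun _ _ => rfl⟩

theorem IsPiecewiseSmooth.add {g h : Vec d → F} (hg : M.IsPiecewiseSmooth g)
    (hh : M.IsPiecewiseSmooth h) : M.IsPiecewiseSmooth fun x => g x + h x :=
  hg.comp₂ hh (Φ := fun p => p.1 + p.2) (by fun_prop)

theorem IsPiecewiseSmooth.sub {g h : Vec d → F} (hg : M.IsPiecewiseSmooth g)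
    (hh : M.IsPiecewiseSmooth h) : M.IsPiecewiseSmooth fun x => g x - h x :=
  hg.comp₂ hh (Φ := fun p => p.1 - p.2) (by fun_prop)

theorem IsPiecewiseSmooth.smul {g : Vec d → ℝ} {h : Vec d → F} (hg : M.IsPiecewiseSmooth g)
    (hh : M.IsPiecewiseSmooth h) : M.IsPiecewiseSmooth fun x => g x • h x :=
  hg.comp₂ hh (Φ := fun p => p.1 • p.2) (by fun_prop)

theorem IsPiecewiseSmooth.mul {g h : Vec d → ℝ} (hg : M.IsPiecewiseSmooth g)
    (hh : M.IsPiecewiseSmooth h) : M.IsPiecewiseSmooth fun x => g x * h x :=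
  hg.smul hh

theorem IsPiecewiseSmooth.const_mul {g : Vec d → ℝ} (hg : M.IsPiecewiseSmooth g) (c : ℝ) :
    M.IsPiecewiseSmooth fun x => c * g x :=
  (isPiecewiseSmooth_const c).mul hg

theorem IsPiecewiseSmooth.inner {g h : Vec d → Vec d} (hg : M.IsPiecewiseSmooth g)
    (hh : M.IsPiecewiseSmooth h) : M.IsPiecewiseSmooth fun x => ⟪g x, h x⟫ :=
  hg.comp₂ hh (Φ := fun p => ⟪p.1, p.2⟫) (contDiff_fst.inner ℝ contDiff_snd)

theorem IsPiecewiseSmooth.norm_sq {g : Vec d → Vec d} (hg : M.IsPiecewiseSmooth g) :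
    M.IsPiecewiseSmooth fun x => ‖g x‖ ^ 2 := by
  simpa only [real_inner_self_eq_norm_sq] using hg.inner hg

theorem IsPiecewiseSmooth.fderiv_apply {g : Vec d → F} {h : Vec d → Vec d}
    (hg : M.IsPiecewiseSmooth g) (hh : M.IsPiecewiseSmooth h) :
    M.IsPiecewiseSmooth fun x => fderiv ℝ g x (h x) := by
  have hf : M.IsPiecewiseSmooth (fderiv ℝ g) := by
    intro s hs
    obtain ⟨G, hG, hgG⟩ := hg s hs
    exact ⟨fderiv ℝ G, hG.fderiv_right (by simp), fun x hx =>
      Filter.EventuallyEq.fderiv_eq (eventually_of_mem (isOpen_interior.mem_nhds hx) hgG)⟩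
  exact hf.comp₂ hh (Φ := fun p => p.1 p.2) (by fun_prop)

theorem IsPiecewiseSmooth.sum {ι : Type*} [Fintype ι] {g : ι → Vec d → F}
    (hg : ∀ i, M.IsPiecewiseSmooth (g i)) : M.IsPiecewiseSmooth fun x => ∑ i, g i x := by
  intro s hs
  choose G hG hgG using fun i => hg i s hs
  exact ⟨fun x => ∑ i, G i x, ContDiff.sum fun i _ => hG i,
    fun x hx => Finset.sum_congr rfl fun i _ => hgG i x hx⟩

theorem IsPiecewiseSmooth.apply {g : Vec d → Vec d} (hg : M.IsPiecewiseSmooth g) (i : Fin d) :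
    M.IsPiecewiseSmooth fun x => g x i :=
  hg.comp₂ hg (Φ := fun p => p.1 i) (by fun_prop)

theorem IsPiecewiseSmooth.grad_apply {g : Vec d → Vec d} (hg : M.IsPiecewiseSmooth g)
    (i j : Fin d) : M.IsPiecewiseSmooth fun x => grad g x i j :=
  (hg.fderiv_apply (isPiecewiseSmooth_const (EuclideanSpace.single j 1))).apply i

theorem IsPiecewiseSmooth.ddot_grad {g : Vec d → Vec d} (hg : M.IsPiecewiseSmooth g) :
    M.IsPiecewiseSmooth fun x => ddot (grad g x) (grad g x) :=
  IsPiecewiseSmooth.sum fun i => IsPiecewiseSmooth.sum fun j =>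
    (hg.grad_apply i j).mul (hg.grad_apply i j)

theorem IsPiecewiseSmooth.divg {g : Vec d → Vec d} (hg : M.IsPiecewiseSmooth g) :
    M.IsPiecewiseSmooth fun x => divg g x :=
  IsPiecewiseSmooth.sum fun i => hg.grad_apply i i

theorem IsPiecewisePoly.isPiecewiseSmooth {k : ℕ} {g : Vec d → ℝ} (hg : M.IsPiecewisePoly k g) :
    M.IsPiecewiseSmooth g := by
  intro s hs
  obtain ⟨P, -, hP⟩ := hg s hs
  exact ⟨_, contDiff_eval P, hP⟩

theorem IsVelocity.isPiecewiseSmooth {u : Vec d → Vec d} (hu : M.IsVelocity u) :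
    M.IsPiecewiseSmooth u := by
  intro s hs
  choose P _ hP using fun i => hu.2.2 i s hs
  refine ⟨fun x => WithLp.toLp 2 fun i => MvPolynomial.eval (fun i => x i) (P i), ?_, ?_⟩
  · exact (contDiff_euclidean).2 fun i => contDiff_eval (P i)
  · intro x hx
    ext i
    exact hP i x hx

/-- The divergence of a velocity field is an admissible pressure test function. -/
theorem IsVelocity.isPressure_divg {u : Vec d → Vec d} (hu : M.IsVelocity u) :
    M.IsPressure (divg u) := by
  intro s hs
  choose P hPd hP using fun i => hu.2.2 i s hs
  refine ⟨∑ i, MvPolynomial.pderiv i (P i), ?_, fun x hx => ?_⟩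
  · exact MvPolynomial.totalDegree_finsetSum_le fun i _ => totalDegree_pderiv_le (hPd i) i
  · have hu' : fderiv ℝ u x = fderiv ℝ (fun x : Vec d => (WithLp.toLp 2 fun i =>
        MvPolynomial.eval (fun i => x i) (P i) : Vec d)) x := by
      refine Filter.EventuallyEq.fderiv_eq (eventually_of_mem (isOpen_interior.mem_nhds hx) ?_)
      intro y hy
      ext i
      exact hP i y hy
    rw [divg_eq_sum, hu', map_sum]
    refine Finset.sum_congr rfl fun i _ => ?_
    rw [← fderiv_eval_single]
    have hd : DifferentiableAt ℝ (fun x : Vec d => (WithLp.toLp 2 fun i =>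
        MvPolynomial.eval (fun i => x i) (P i) : Vec d)) x :=
      ((contDiff_euclidean (n := ∞)).2 fun i => contDiff_eval (P i)).differentiable (by simp) x
    have hp := ((EuclideanSpace.proj i : Vec d →L[ℝ] ℝ).hasFDerivAt.comp x hd.hasFDerivAt).fderiv
    exact (DFunLike.congr_fun hp (EuclideanSpace.single i 1)).symm

/-- Functions of a stress field are constant in every element. -/
theorem IsStress.isPiecewiseSmooth_comp {ψ φ : Vec d → Mat d} (hψ : M.IsStress ψ)
    (hφ : M.IsStress φ) (Φ : Mat d → Mat d → F) :
    M.IsPiecewiseSmooth fun x => Φ (ψ x) (φ x) := by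
  intro s hs
  obtain ⟨A, -, hA⟩ := hψ s hs
  obtain ⟨B, -, hB⟩ := hφ s hs
  exact ⟨fun _ => Φ A B, contDiff_const, fun x hx => by simp only [hA x hx, hB x hx]⟩

end Smooth

theorem interior_ae_eq_cell (s : Finset (Vec d)) :
    (interior (convexHull ℝ (s : Set (Vec d))) : Set (Vec d)) =ᵐ[volume]
      convexHull ℝ (s : Set (Vec d)) :=
  interior_ae_eq_of_null_frontier ((convex_convexHull ℝ _).addHaar_frontier _)

theorem ae_mem_interior (s : Finset (Vec d)) :
    ∀ᵐ x ∂(volume.restrict (convexHull ℝ (s : Set (Vec d)))),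
      x ∈ interior (convexHull ℝ (s : Set (Vec d))) := by
  rw [← Measure.restrict_congr_set (interior_ae_eq_cell s)]
  exact ae_restrict_mem isOpen_interior.measurableSet

/-- What is missing from `D` lies on the frontiers of finitely many convex sets, which are null; no
information on the boundary of `D` is needed. -/
theorem biUnion_interior_ae_eq :
    (⋃ s ∈ M.cells, interior (convexHull ℝ (s : Set (Vec d))) : Set (Vec d)) =ᵐ[volume] D := by
  have h1 : (⋃ s ∈ M.cells, interior (convexHull ℝ (s : Set (Vec d)))) ⊆ D :=
    Set.iUnion₂_subset fun s hs => M.interior_subset s hs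
  have h2 : D \ (⋃ s ∈ M.cells, interior (convexHull ℝ (s : Set (Vec d)))) ⊆
      ⋃ s ∈ M.cells, frontier (convexHull ℝ (s : Set (Vec d))) := by
    rintro x ⟨hxD, hx⟩
    have hxc : x ∈ closure D := subset_closure hxD
    rw [M.closure_eq] at hxc
    simp only [Set.mem_iUnion, exists_prop, not_exists, not_and] at hxc hx ⊢
    obtain ⟨s, hs, hxs⟩ := hxc
    exact ⟨s, hs, subset_closure hxs, hx s hs⟩
  have h3 : volume (⋃ s ∈ M.cells, frontier (convexHull ℝ (s : Set (Vec d)))) = 0 :=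
    (measure_biUnion_null_iff M.cells.countable_toSet).2 fun s _ =>
      (convex_convexHull ℝ _).addHaar_frontier _
  exact ae_eq_set.2 ⟨by rw [Set.sdiff_eq_empty.2 h1, measure_empty], measure_mono_null h2 h3⟩

theorem ae_mem_interior_cell :
    ∀ᵐ x ∂(volume.restrict D), ∃ s ∈ M.cells, x ∈ interior (convexHull ℝ (s : Set (Vec d))) := by
  rw [← Measure.restrict_congr_set M.biUnion_interior_ae_eq]
  filter_upwards [ae_restrict_mem (MeasurableSet.biUnion M.cells.countable_toSet
    fun s _ => isOpen_interior.measurableSet)] with x hx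
  simpa only [Set.mem_iUnion, exists_prop] using hx

variable {M}

theorem IsPiecewiseSmooth.integrableOn_cell {g : Vec d → ℝ} (hg : M.IsPiecewiseSmooth g)
    {s : Finset (Vec d)} (hs : s ∈ M.cells) :
    IntegrableOn g (convexHull ℝ (s : Set (Vec d))) := by
  obtain ⟨G, hG, hgG⟩ := hg s hs
  have h : IntegrableOn G (convexHull ℝ (s : Set (Vec d))) :=
    hG.continuous.continuousOn.integrableOn_compact (isCompact_cell s)
  exact h.congr_fun_ae ((ae_mem_interior s).mono fun x hx => (hgG x hx).symm)

theorem IsPiecewiseSmooth.integrableOn {g : Vec d → ℝ} (hg : M.IsPiecewiseSmooth g) :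
    IntegrableOn g D := by
  have h : IntegrableOn g (⋃ s ∈ M.cells, interior (convexHull ℝ (s : Set (Vec d)))) :=
    (integrableOn_finset_iUnion).2 fun s hs => (hg.integrableOn_cell hs).mono_set _root_.interior_subset
  exact h.congr_set_ae M.biUnion_interior_ae_eq.symm

theorem IsPiecewiseSmooth.sum_setIntegral {g : Vec d → ℝ} (hg : M.IsPiecewiseSmooth g) :
    ∑ s ∈ M.cells, ∫ x in convexHull ℝ (s : Set (Vec d)), g x = ∫ x in D, g x := by
  rw [← setIntegral_congr_set M.biUnion_interior_ae_eq, integral_biUnion_finset]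
  · exact Finset.sum_congr rfl fun s _ => (setIntegral_congr_set (interior_ae_eq_cell s)).symm
  · exact fun s _ => isOpen_interior.measurableSet
  · exact fun s hs t ht hst => M.disjoint_interior hs ht hst
  · exact fun s hs => (hg.integrableOn_cell hs).mono_set _root_.interior_subset

/-- A discretely divergence-free velocity field is divergence free in every element. -/
theorem IsVelocity.divg_ae_eq_zero {u : Vec d → Vec d} (hu : M.IsVelocity u)
    (hdiv : M.IsDiscretelyDivFree u) : ∀ᵐ x ∂(volume.restrict D), divg u x = 0 := by
  -- The constraint is tested with the divergence itself, so its square has zero integral.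
  have h := hdiv _ hu.isPressure_divg
  have hi := (hu.isPiecewiseSmooth.divg.mul hu.isPiecewiseSmooth.divg).integrableOn
  have := (integral_eq_zero_iff_of_nonneg (fun x => mul_self_nonneg (divg u x)) hi).1 h
  exact this.mono fun x hx => mul_self_eq_zero.1 hx

theorem ae_cell_of_ae {P : Vec d → Prop} (h : ∀ᵐ x ∂(volume.restrict D), P x)
    {s : Finset (Vec d)} (hs : s ∈ M.cells) :
    ∀ᵐ x ∂(volume.restrict (convexHull ℝ (s : Set (Vec d)))), P x := by
  rw [← Measure.restrict_congr_set (interior_ae_eq_cell s)]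
  exact ae_restrict_of_ae_restrict_of_subset (M.interior_subset s hs) h

/-- Smoothness is known only in open elements; continuity extends the identification to the faces,
where the traces are integrated. -/
theorem eqOn_cell {w W : Vec d → Vec d} (hw : ContinuousOn w (closure D)) (hW : Continuous W)
    {s : Finset (Vec d)} (hs : s ∈ M.cells)
    (h : ∀ x ∈ interior (convexHull ℝ (s : Set (Vec d))), w x = W x) :
    Set.EqOn w W (convexHull ℝ (s : Set (Vec d))) := by
  have h' : Set.EqOn w W (interior (convexHull ℝ (s : Set (Vec d)))) := h
  exact h'.of_subset_closure (hw.mono (M.cell_subset_closure hs)) hW.continuousOn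
    _root_.interior_subset (M.closure_interior_cell hs).ge

end Mesh

/-! ### Elementwise integration by parts and the upwind jump terms. -/

namespace Mesh

variable {d : ℕ} {D : Set (Vec d)} {M : Mesh d D}

theorem eventually_mem_interior_cell (hd : 1 ≤ d) {s : Finset (Vec d)} (hs : s ∈ M.cells) (a : s)
    {x w : Vec d} (hx : (M.basis hs).coord a x = 0)
    (hpos : ∀ k, k ≠ a → 0 < (M.basis hs).coord k x) :
    ∀ᶠ δ in 𝓝 (0 : ℝ), 0 < δ * ⟪M.innerNormal s a, w⟫ →
      x + δ • w ∈ interior (convexHull ℝ (s : Set (Vec d))) := by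
  have := M.nontrivial_cell hd hs
  have h := eventually_add_smul_mem_interior (M.basis hs) (w := w) hx hpos
  rw [M.range_basis hs] at h
  refine h.mono fun δ hδ hpos => hδ ?_
  rw [M.innerNormal_eq hs, real_inner_smul_left, mul_left_comm] at hpos
  have hg := norm_pos_iff.2 (coordGrad_ne_zero (M.basis hs) a)
  exact pos_of_mul_pos_right hpos (inv_nonneg.2 hg.le)

theorem limUnder_eq_of_eventually {l : Filter ℝ} [l.NeBot] {φ : Vec d → Mat d} {x w : Vec d}
    {O : Set (Vec d)} {A : Mat d} (hO : ∀ᶠ δ in l, x + δ • w ∈ O) (hA : ∀ y ∈ O, φ y = A) :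
    limUnder l (fun δ => φ (x + δ • w)) = A :=
  (tendsto_const_nhds.congr' (hO.mono fun _ hδ => (hA _ hδ).symm)).limUnder_eq

variable [DecidableEq (Vec d)]

theorem setIntegral_divg_cell (hd : 1 ≤ d) {w : Vec d → Vec d} (hw : ContinuousOn w (closure D))
    (hs : M.IsPiecewiseSmooth w) {s : Finset (Vec d)} (hsM : s ∈ M.cells) :
    ∫ x in convexHull ℝ (s : Set (Vec d)), divg w x =
      -∑ a ∈ s, ∫ x in convexHull ℝ (s.erase a : Set (Vec d)),
        ⟪M.innerNormal s a, w x⟫ ∂μHE[d - 1] := by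
  have := M.nontrivial_cell hd hsM
  obtain ⟨W, hW, hwW⟩ := hs s hsM
  have heq := eqOn_cell hw hW.continuous hsM hwW
  have h1 : ∫ x in convexHull ℝ (s : Set (Vec d)), divg w x =
      ∫ x in convexHull ℝ (s : Set (Vec d)), divg W x := by
    refine integral_congr_ae ((ae_mem_interior s).mono fun x hx => ?_)
    have : fderiv ℝ w x = fderiv ℝ W x :=
      Filter.EventuallyEq.fderiv_eq (eventually_of_mem (isOpen_interior.mem_nhds hx) hwW)
    simp only [divg_eq_sum, this]
  have h2 := setIntegral_divg_convexHull_range (M.basis hsM) (hW.of_le (by simp))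
  rw [M.range_basis hsM] at h2
  rw [h1, h2, ← Finset.sum_coe_sort s]
  congr 1
  refine Finset.sum_congr rfl fun a _ => ?_
  rw [M.convexHull_erase hsM a, M.innerNormal_eq hsM]
  refine setIntegral_congr_fun (isCompact_oppositeFace _ _).measurableSet fun x hx => ?_
  have hx' : x ∈ convexHull ℝ (s : Set (Vec d)) := (M.mem_cell_iff hsM x).2 hx.2
  simp only [heq hx']

/-- On almost every point of a face, the barycentric coordinates of the vertices of this face are
positive. -/
theorem ae_erase_coord_pos (hd : 2 ≤ d) {s : Finset (Vec d)} (hs : s ∈ M.cells) (a : s) :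
    ∀ᵐ x ∂(μHE[d - 1].restrict (convexHull ℝ (s.erase a : Set (Vec d)))),
      (M.basis hs).coord a x = 0 ∧ ∀ k, k ≠ a → 0 < (M.basis hs).coord k x := by
  rw [M.convexHull_erase hs a]
  have hc : 3 ≤ Fintype.card s := by
    rw [Fintype.card_coe, M.card_eq s hs]; omega
  filter_upwards [ae_oppositeFace_coord_pos (M.basis hs) hc a,
    ae_restrict_mem (isCompact_oppositeFace (M.basis hs) a).measurableSet] with x h1 h2
  exact ⟨h2.1, h1⟩

/-- Elementwise integration by parts against elementwise constant weights: only the jumps across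
the internal faces contribute. -/
theorem sum_mul_setIntegral_divg (hd : 2 ≤ d) (hD : IsOpen D) {ν : Finset (Vec d) → Vec d}
    {P Q : Finset (Vec d) → Finset (Vec d)} {α β : Finset (Vec d) → Vec d}
    (hadj : ∀ f ∈ M.internalFaces, M.IsAdjacentPair f (ν f) (P f) (Q f) (α f) (β f))
    {w : Vec d → Vec d} (hw : ContinuousOn w (closure D)) (hw0 : ∀ x ∈ frontier D, w x = 0)
    (hs : M.IsPiecewiseSmooth w) (g : Finset (Vec d) → ℝ) :
    ∑ s ∈ M.cells, g s * ∫ x in convexHull ℝ (s : Set (Vec d)), divg w x =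
      -∑ f ∈ M.internalFaces, (g (P f) - g (Q f)) *
        ∫ x in convexHull ℝ (f : Set (Vec d)), ⟪ν f, w x⟫ ∂μHE[d - 1] := by
  set T : Finset (Vec d) → Vec d → ℝ := fun s a =>
    ∫ x in convexHull ℝ (s.erase a : Set (Vec d)), ⟪M.innerNormal s a, w x⟫ ∂μHE[d - 1] with hT
  have h1 : ∑ s ∈ M.cells, g s * ∫ x in convexHull ℝ (s : Set (Vec d)), divg w x =
      -∑ p ∈ M.cells.sigma fun s => s, g p.1 * T p.1 p.2 := by
    rw [Finset.sum_sigma, ← Finset.sum_neg_distrib]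
    refine Finset.sum_congr rfl fun s hsM => ?_
    rw [setIntegral_divg_cell (by omega) hw hs hsM, mul_neg, Finset.mul_sum]
  -- The sum runs over pairs of an element and a vertex, that is, over oriented faces. Those on the
  -- boundary drop out because `w` vanishes there.
  have h2 : ∑ p ∈ M.cells.sigma fun s => s, g p.1 * T p.1 p.2 =
      ∑ p ∈ (M.cells.sigma fun s => s).filter (fun p => p.1.erase p.2 ∈ M.internalFaces),
        g p.1 * T p.1 p.2 := by
    symm
    refine Finset.sum_filter_of_ne fun p hp hne => ?_
    obtain ⟨hpM, hpa⟩ := Finset.mem_sigma.1 hp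
    by_contra hf
    refine hne ?_
    have h0 : T p.1 p.2 = 0 := by
      refine integral_eq_zero_of_ae ?_
      filter_upwards [ae_erase_coord_pos hd hpM ⟨p.2, hpa⟩] with x hx
      rw [hw0 x (M.mem_frontier_of_notMem_internalFaces hD hpM ⟨p.2, hpa⟩ hf hx.1 hx.2),
        inner_zero_right]
      rfl
    rw [h0, mul_zero]
  have h3 := Finset.sum_fiberwise_of_maps_to
    (s := (M.cells.sigma fun s => s).filter (fun p => p.1.erase p.2 ∈ M.internalFaces))
    (t := M.internalFaces) (g := fun p => p.1.erase p.2)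
    (fun p hp => (Finset.mem_filter.1 hp).2) fun p => g p.1 * T p.1 p.2
  rw [h1, h2, ← h3]
  congr 1
  refine Finset.sum_congr rfl fun f hf => ?_
  have h := hadj f hf
  have hfib : ((M.cells.sigma fun s => s).filter
      (fun p => p.1.erase p.2 ∈ M.internalFaces)).filter (fun p => p.1.erase p.2 = f) =
      {⟨P f, α f⟩, ⟨Q f, β f⟩} := by
    ext ⟨s, a⟩
    simp only [Finset.mem_filter, Finset.mem_sigma, Finset.mem_insert, Finset.mem_singleton,
      Sigma.mk.injEq, heq_eq_eq]
    constructor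
    · rintro ⟨⟨⟨hs, ha⟩, -⟩, he⟩
      exact h.eq_or_eq s hs a ha he
    · rintro (⟨rfl, rfl⟩ | ⟨rfl, rfl⟩)
      · exact ⟨⟨⟨h.left_mem, h.left_vertex⟩, by rwa [h.left_erase]⟩, h.left_erase⟩
      · exact ⟨⟨⟨h.right_mem, h.right_vertex⟩, by rwa [h.right_erase]⟩, h.right_erase⟩
  have hTP : T (P f) (α f) = ∫ x in convexHull ℝ (f : Set (Vec d)), ⟪ν f, w x⟫ ∂μHE[d - 1] := by
    simp only [hT, h.left_erase, h.left_normal]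
  have hTQ : T (Q f) (β f) = -∫ x in convexHull ℝ (f : Set (Vec d)), ⟪ν f, w x⟫ ∂μHE[d - 1] := by
    simp only [hT, h.right_erase, h.right_normal, inner_neg_left, integral_neg]
  rw [hfib, Finset.sum_pair (fun hc => h.ne (Sigma.mk.inj hc).1), hTP, hTQ]
  ring

/-- The jump term on an internal face dominates the flux of the entropy `tr (e^ψ - ψ)`. -/
theorem IsAdjacentPair.le_setIntegral_jump (hd : 2 ≤ d) {f : Finset (Vec d)} {n : Vec d}
    {s t : Finset (Vec d)} {a b : Vec d} (h : M.IsAdjacentPair f n s t a b)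
    {u : Vec d → Vec d} (hu : ContinuousOn u (closure D)) {ψ : Vec d → Mat d} {A B : Mat d}
    (hA : A.IsSymm) (hB : B.IsSymm)
    (hψA : ∀ x ∈ interior (convexHull ℝ (s : Set (Vec d))), ψ x = A)
    (hψB : ∀ x ∈ interior (convexHull ℝ (t : Set (Vec d))), ψ x = B) {c : ℝ} (hc : 0 ≤ c) :
    c * ((NormedSpace.exp A - A).trace - (NormedSpace.exp B - B).trace) *
        ∫ x in convexHull ℝ (f : Set (Vec d)), ⟪n, u x⟫ ∂μHE[d - 1] ≤
      ∫ x in convexHull ℝ (f : Set (Vec d)), |⟪u x, n⟫| *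
        ddot (jump u ψ x) (downstream u (fun y => c • (NormedSpace.exp (ψ y) - 1)) x)
          ∂μHE[d - 1] := by
  have := M.nontrivial_cell (by omega) h.left_mem
  set κ := ddot (A - B) (NormedSpace.exp A - 1) with hκ
  set μ := ddot (B - A) (NormedSpace.exp B - 1) with hμ
  have hfc : convexHull ℝ (f : Set (Vec d)) = oppositeFace (M.basis h.left_mem)
      ⟨a, h.left_vertex⟩ := by
    simpa only [h.left_erase] using M.convexHull_erase h.left_mem ⟨a, h.left_vertex⟩
  have hcu : ContinuousOn u (convexHull ℝ (f : Set (Vec d))) := by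
    refine hu.mono (Set.Subset.trans ?_ (M.cell_subset_closure h.left_mem))
    rw [← h.left_erase]
    exact convexHull_mono (by exact_mod_cast Finset.erase_subset _ _)
  have hz : ContinuousOn (fun x => ⟪n, u x⟫) (convexHull ℝ (f : Set (Vec d))) :=
    continuousOn_const.inner hcu
  have hint {g : Vec d → ℝ} (hg : ContinuousOn g (convexHull ℝ (f : Set (Vec d)))) :
      IntegrableOn g (convexHull ℝ (f : Set (Vec d))) μHE[d - 1] := by
    rw [hfc] at hg ⊢
    exact integrableOn_oppositeFace _ _ hg
  have hs := ae_erase_coord_pos hd h.left_mem ⟨a, h.left_vertex⟩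
  have ht := ae_erase_coord_pos hd h.right_mem ⟨b, h.right_vertex⟩
  simp only [h.left_erase] at hs
  simp only [h.right_erase] at ht
  -- Where `⟪n, u x⟫ > 0` the flow passes from `t` into `s`, so the downstream value is `A`; where
  -- it is negative the roles are exchanged. Where it vanishes, the one-sided limits are irrelevant
  -- because their weight is zero.
  have hval : ∀ᵐ x ∂(μHE[d - 1].restrict (convexHull ℝ (f : Set (Vec d)))),
      c * (max ⟪n, u x⟫ 0 * κ + max (-⟪n, u x⟫) 0 * μ) = |⟪u x, n⟫| *
        ddot (jump u ψ x) (downstream u (fun y => c • (NormedSpace.exp (ψ y) - 1)) x) := by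
    filter_upwards [hs, ht] with x hxs hxt
    have es := eventually_mem_interior_cell (by omega) h.left_mem ⟨a, h.left_vertex⟩ (w := u x)
      hxs.1 hxs.2
    have et := eventually_mem_interior_cell (by omega) h.right_mem ⟨b, h.right_vertex⟩ (w := u x)
      hxt.1 hxt.2
    rw [h.left_normal] at es
    rw [h.right_normal, inner_neg_left] at et
    rw [real_inner_comm n (u x)]
    have hpos : ∀ᶠ δ in 𝓝[>] (0 : ℝ), 0 < δ := self_mem_nhdsWithin
    have hneg : ∀ᶠ δ in 𝓝[<] (0 : ℝ), δ < 0 := self_mem_nhdsWithin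
    have hφA : ∀ y ∈ interior (convexHull ℝ (s : Set (Vec d))),
        (fun y => c • (NormedSpace.exp (ψ y) - 1)) y = c • (NormedSpace.exp A - 1) :=
      fun y hy => by simp only [hψA y hy]
    have hφB : ∀ y ∈ interior (convexHull ℝ (t : Set (Vec d))),
        (fun y => c • (NormedSpace.exp (ψ y) - 1)) y = c • (NormedSpace.exp B - 1) :=
      fun y hy => by simp only [hψB y hy]
    rcases lt_trichotomy ⟪n, u x⟫ 0 with hz | hz | hz
    · have e1 : ∀ᶠ δ in 𝓝[>] (0 : ℝ), x + δ • u x ∈ interior (convexHull ℝ (t : Set (Vec d))) := by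
        filter_upwards [et.filter_mono nhdsWithin_le_nhds, hpos] with δ h1 h2
        exact h1 (mul_pos h2 (by linarith))
      have e2 : ∀ᶠ δ in 𝓝[<] (0 : ℝ), x + δ • u x ∈ interior (convexHull ℝ (s : Set (Vec d))) := by
        filter_upwards [es.filter_mono nhdsWithin_le_nhds, hneg] with δ h1 h2
        exact h1 (mul_pos_of_neg_of_neg h2 hz)
      rw [jump, downstream, upstream, downstream, limUnder_eq_of_eventually e1 hψB,
        limUnder_eq_of_eventually e2 hψA, limUnder_eq_of_eventually e1 hφB, ddot_smul_right,
        max_eq_right hz.le, max_eq_left (by linarith), abs_of_neg hz, ← hμ]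
      ring
    · rw [hz]; simp
    · have e1 : ∀ᶠ δ in 𝓝[>] (0 : ℝ), x + δ • u x ∈ interior (convexHull ℝ (s : Set (Vec d))) := by
        filter_upwards [es.filter_mono nhdsWithin_le_nhds, hpos] with δ h1 h2
        exact h1 (mul_pos h2 hz)
      have e2 : ∀ᶠ δ in 𝓝[<] (0 : ℝ), x + δ • u x ∈ interior (convexHull ℝ (t : Set (Vec d))) := by
        filter_upwards [et.filter_mono nhdsWithin_le_nhds, hneg] with δ h1 h2
        exact h1 (mul_pos_of_neg_of_neg h2 (by linarith))
      rw [jump, downstream, upstream, downstream, limUnder_eq_of_eventually e1 hψA,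
        limUnder_eq_of_eventually e2 hψB, limUnder_eq_of_eventually e1 hφA, ddot_smul_right,
        max_eq_left hz.le, max_eq_right (by linarith), abs_of_pos hz, ← hκ]
      ring
  rw [← integral_congr_ae hval, ← integral_const_mul]
  -- Klein's inequality is needed in both directions, as the flow may change sign along the face.
  have h1 := trace_increment_le_ddot hA hB
  have h2 := trace_increment_le_ddot hB hA
  refine integral_mono (hint (hz.const_mul _))
    (hint ((((hz.sup continuousOn_const).mul_const κ).add
      ((hz.neg.sup continuousOn_const).mul_const μ)).const_mul c)) fun x => ?_
  set z := ⟪n, u x⟫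
  rw [mul_assoc]
  refine mul_le_mul_of_nonneg_left ?_ hc
  rcases le_total 0 z with hz | hz
  · rw [max_eq_left hz, max_eq_right (by linarith)]
    nlinarith
  · rw [max_eq_right hz, max_eq_left (by linarith)]
    nlinarith

end Mesh

/-! ### The discrete energy balance. -/

variable {d : ℕ} {D : Set (Vec d)} {M : Mesh d D}

theorem divg_zero (x : Vec d) : divg (fun _ => (0 : Vec d)) x = 0 := by
  simp [divg_eq_sum]

theorem grad_zero (x : Vec d) : grad (fun _ => (0 : Vec d)) x = 0 := by
  ext i j
  simp [grad]

theorem ddot_zero_right (A : Mat d) : ddot A 0 = 0 := by simp [ddot]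

theorem downstream_zero (u : Vec d → Vec d) (x : Vec d) :
    downstream u (fun _ => (0 : Mat d)) x = 0 :=
  (tendsto_const_nhds (x := (0 : Mat d)) (f := 𝓝[>] (0 : ℝ))).limUnder_eq

variable {ν : Finset (Vec d) → Vec d} {Re Wi ε Δt : ℝ} {u₀ u : Vec d → Vec d}
  {ψ₀ ψ : Vec d → Mat d} {p : Vec d → ℝ}

/-- Testing with `v = 0` and `φ = 0` isolates the constraint; this passes incompressibility on to
the next step. -/
theorem IsLogP0DGStep.isDiscretelyDivFree
    (h : IsLogP0DGStep M ν Re Wi ε Δt u₀ ψ₀ u p ψ) : M.IsDiscretelyDivFree u := by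
  obtain ⟨hu, -, -, Ω, B, N, -, hform⟩ := h
  intro q hq
  have hv : M.IsVelocity fun _ => (0 : Vec d) :=
    ⟨continuousOn_const, fun _ _ => rfl, fun i s _ => ⟨0, by simp, fun x _ => by simp⟩⟩
  have hφ : M.IsStress fun _ => (0 : Mat d) := fun s _ => ⟨0, Matrix.isSymm_zero, fun _ _ => rfl⟩
  have h0 := hform _ q _ hv hq hφ
  simp only [logP0DGForm, divg_zero, grad_zero, ddot_zero_right, downstream_zero, inner_zero_right,
    mul_zero, sub_zero, zero_add, add_zero, integral_zero, Finset.sum_const_zero] at h0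
  rwa [(hq.isPiecewiseSmooth.mul hu.isPiecewiseSmooth.divg).sum_setIntegral] at h0

open Classical in
/-- The convection term does not contribute to the energy balance. -/
theorem setIntegral_convection_eq_zero (hd : 2 ≤ d) (hD : IsOpen D) (hν : M.IsUnitNormal ν)
    (hu₀ : M.IsVelocity u₀) (hdiv : M.IsDiscretelyDivFree u₀) (hu : M.IsVelocity u) :
    ∫ x in D, ⟪fderiv ℝ u x (u₀ x), u x⟫ = 0 := by
  choose! P Q α β hadj using fun f hf => M.exists_isAdjacentPair (by omega) hν (f := f) hf
  have hus := hu.isPiecewiseSmooth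
  have hus₀ := hu₀.isPiecewiseSmooth
  have hws : M.IsPiecewiseSmooth fun x => ‖u x‖ ^ 2 • u₀ x := hus.norm_sq.smul hus₀
  -- With weights all equal to one there are no jumps: the continuous field `|u|² u₀` has zero total
  -- divergence.
  have h1 := M.sum_mul_setIntegral_divg hd hD hadj
    (w := fun x => ‖u x‖ ^ 2 • u₀ x) ((hu.1.norm.pow 2).smul hu₀.1)
    (fun x hx => by simp [hu₀.2.1 x hx]) hws fun _ => 1
  simp only [one_mul, sub_self, zero_mul, Finset.sum_const_zero, neg_zero] at h1
  rw [hws.divg.sum_setIntegral] at h1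
  have h2 : ∫ x in D, divg (fun x => ‖u x‖ ^ 2 • u₀ x) x =
      ∫ x in D, 2 * ⟪fderiv ℝ u x (u₀ x), u x⟫ := by
    refine integral_congr_ae ?_
    filter_upwards [hu₀.divg_ae_eq_zero hdiv, M.ae_mem_interior_cell] with x hx hxs
    obtain ⟨s, hs, hxs⟩ := hxs
    have diff {v : Vec d → Vec d} (hv : M.IsPiecewiseSmooth v) : DifferentiableAt ℝ v x := by
      obtain ⟨V, hV, hvV⟩ := hv s hs
      exact (hV.differentiable (by simp) x).congr_of_eventuallyEq
        (eventually_of_mem (isOpen_interior.mem_nhds hxs) hvV)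
    have hfd := ((diff hus).hasFDerivAt.norm_sq.smul (diff hus₀).hasFDerivAt).fderiv
    have hfd' : fderiv ℝ (fun x => ‖u x‖ ^ 2 • u₀ x) x = _ := hfd
    rw [divg_eq_sum] at hx ⊢
    rw [hfd']
    have hsum : u₀ x = ∑ k, u₀ x k • EuclideanSpace.single k (1 : ℝ) := by
      ext i
      simp [Finset.sum_apply, Pi.single_apply]
    conv_rhs => rw [hsum, map_sum, sum_inner, Finset.mul_sum]
    simp only [add_apply, smul_apply, ContinuousLinearMap.smulRight_apply, PiLp.add_apply,
      PiLp.smul_apply, smul_eq_mul, Finset.sum_add_distrib, ← Finset.mul_sum, hx, mul_zero, zero_add]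
    rw [Finset.mul_sum]
    refine Finset.sum_congr rfl fun k _ => ?_
    rw [map_smul, real_inner_smul_left, real_inner_comm]
    simp
    ring
  rw [h2, integral_const_mul] at h1
  linarith

open Classical in
/-- The edge terms of the scheme, tested with a multiple of `e^ψ - I`, are nonnegative. -/
theorem sum_setIntegral_jump_nonneg (hd : 2 ≤ d) (hD : IsOpen D) (hν : M.IsUnitNormal ν)
    (hu : M.IsVelocity u) (hdiv : M.IsDiscretelyDivFree u) (hψ : M.IsStress ψ) {c : ℝ}
    (hc : 0 ≤ c) :
    0 ≤ ∑ f ∈ M.internalFaces, ∫ x in convexHull ℝ (f : Set (Vec d)), |⟪u x, ν f⟫| *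
        ddot (jump u ψ x) (downstream u (fun y => c • (NormedSpace.exp (ψ y) - 1)) x)
          ∂μHE[d - 1] := by
  choose! P Q α β hadj using fun f hf => M.exists_isAdjacentPair (by omega) hν (f := f) hf
  choose! A hA hψA using hψ
  -- The weights are the elementwise entropies. As `u` is divergence free in each element, the
  -- fluxes of entropy jumps sum to zero.
  have h1 := M.sum_mul_setIntegral_divg hd hD hadj hu.1 hu.2.1 hu.isPiecewiseSmooth
    fun s => c * (NormedSpace.exp (A s) - A s).trace
  have h2 : ∑ s ∈ M.cells, c * (NormedSpace.exp (A s) - A s).trace *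
      ∫ x in convexHull ℝ (s : Set (Vec d)), divg u x = 0 := by
    refine Finset.sum_eq_zero fun s hs => ?_
    rw [integral_eq_zero_of_ae (Mesh.ae_cell_of_ae (hu.divg_ae_eq_zero hdiv) hs), mul_zero]
  rw [h2, eq_comm, neg_eq_zero] at h1
  rw [← h1]
  refine Finset.sum_le_sum fun f hf => ?_
  rw [← mul_sub]
  have h := hadj f hf
  exact h.le_setIntegral_jump hd hu.1 (hA _ h.left_mem) (hA _ h.right_mem)
    (hψA _ h.left_mem) (hψA _ h.right_mem) hc

/-- The free energy estimate for one step of the scheme. -/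
theorem IsLogP0DGStep.freeEnergy_estimate (hd : 2 ≤ d) (hD : IsOpen D) (hν : M.IsUnitNormal ν)
    (hWi : 0 < Wi) (hε₀ : 0 ≤ ε) (hΔt : 0 < Δt)
    (hu₀ : M.IsVelocity u₀) (hψ₀ : M.IsStress ψ₀) (hdiv : M.IsDiscretelyDivFree u₀)
    (h : IsLogP0DGStep M ν Re Wi ε Δt u₀ ψ₀ u p ψ) :
    freeEnergy D Re Wi ε u ψ - freeEnergy D Re Wi ε u₀ ψ₀
      + (∫ x in D, Re / 2 * ‖u x - u₀ x‖ ^ 2)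
      + Δt * (∫ x in D, ((1 - ε) * ddot (grad u x) (grad u x)
            + ε / (2 * Wi ^ 2) * (NormedSpace.exp (ψ x) + NormedSpace.exp (-ψ x)
                - (2 : ℝ) • (1 : Mat d)).trace)) ≤ 0 := by
  have hdivu := h.isDiscretelyDivFree
  obtain ⟨hu, hp, hψ, Ω, B, N, hdec, hform⟩ := h
  set c := ε / (2 * Wi) with hc
  have hc0 : 0 ≤ c := by positivity
  have hus := hu.isPiecewiseSmooth
  have hus₀ := hu₀.isPiecewiseSmooth
  have hφ : M.IsStress fun x => c • (NormedSpace.exp (ψ x) - 1) := by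
    intro s hs
    obtain ⟨A, hA, hAψ⟩ := hψ s hs
    exact ⟨c • (NormedSpace.exp A - 1), ((isSymm_exp hA).sub Matrix.isSymm_one).smul c,
      fun x hx => by simp only [hAψ x hx]⟩
  have h0 := hform u p _ hu hp hφ
  have hjump := sum_setIntegral_jump_nonneg hd hD hν hu₀ hdiv hψ hc0
  set E : Mat d → ℝ := fun A => (NormedSpace.exp A - A - 1).trace with hE
  set K : Vec d → ℝ := fun x => (1 - ε) * ddot (grad u x) (grad u x)
    + ε / (2 * Wi ^ 2) * (NormedSpace.exp (ψ x) + NormedSpace.exp (-ψ x)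
      - (2 : ℝ) • (1 : Mat d)).trace with hK
  -- The cell integrand after the pressure has cancelled and the stress identity has eliminated `Ω`,
  -- `B` and `N`.
  set R : Vec d → ℝ := fun x => Re * (1 / Δt * ⟪u x - u₀ x, u x⟫)
    + Re * ⟪fderiv ℝ u x (u₀ x), u x⟫
    + 1 / Δt * (c * ddot (ψ x - ψ₀ x) (NormedSpace.exp (ψ x) - 1)) + K x with hR
  have hKs : M.IsPiecewiseSmooth K :=
    (hus.ddot_grad.const_mul (1 - ε)).add (hψ.isPiecewiseSmooth_comp hψ fun A _ =>
      ε / (2 * Wi ^ 2) * (NormedSpace.exp A + NormedSpace.exp (-A)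
        - (2 : ℝ) • (1 : Mat d)).trace)
  have hTs : M.IsPiecewiseSmooth fun x => ⟪fderiv ℝ u x (u₀ x), u x⟫ :=
    (hus.fderiv_apply hus₀).inner hus
  have hRs : M.IsPiecewiseSmooth R :=
    (((((hus.sub hus₀).inner hus).const_mul (1 / Δt)).const_mul Re).add
      (hTs.const_mul Re)).add (hψ.isPiecewiseSmooth_comp hψ₀ fun A A₀ =>
        1 / Δt * (c * ddot (A - A₀) (NormedSpace.exp A - 1))) |>.add hKs
  have hcells : ∑ s ∈ M.cells, ∫ x in convexHull ℝ (s : Set (Vec d)),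
      (Re * ⟪(1 / Δt) • (u x - u₀ x) + fderiv ℝ u x (u₀ x), u x⟫
      - p x * divg u x + p x * divg u x + (1 - ε) * ddot (grad u x) (grad u x)
      + ε / Wi * ddot (NormedSpace.exp (ψ x)) (grad u x)
      + ddot ((1 / Δt) • (ψ x - ψ₀ x)) (c • (NormedSpace.exp (ψ x) - 1))
      - ddot (Ω x * ψ x - ψ x * Ω x) (c • (NormedSpace.exp (ψ x) - 1))
      - 2 * ddot (B x) (c • (NormedSpace.exp (ψ x) - 1))
      - 1 / Wi * ddot (NormedSpace.exp (-ψ x) - 1) (c • (NormedSpace.exp (ψ x) - 1))) =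
      ∫ x in D, R x := by
    rw [← hRs.sum_setIntegral]
    refine Finset.sum_congr rfl fun s hs => integral_congr_ae ?_
    filter_upwards [Mesh.ae_mem_interior s, Mesh.ae_cell_of_ae (hu.divg_ae_eq_zero hdivu) hs]
      with x hx hdx
    obtain ⟨hΩ, hN, hB, -, hG⟩ := hdec.pointwise s hs x hx
    obtain ⟨A, hA, hAψ⟩ := hψ s hs
    have hsym : (ψ x).IsSymm := by rw [hAψ x hx]; exact hA
    have hid := stress_energy_identity hsym hΩ hN hB hG hdx Wi ε
    rw [← hc] at hid
    simp only [hR, hK]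
    rw [← hid, inner_add_left, real_inner_smul_left, ddot_smul_left,
      ddot_smul_right c (ψ x - ψ₀ x)]
    ring
  have h1 : ∫ x in D, R x ≤ 0 := by
    have h0' : (∫ x in D, R x) + ∑ f ∈ M.internalFaces, ∫ x in convexHull ℝ (f : Set (Vec d)),
        |⟪u₀ x, ν f⟫| * ddot (jump u₀ ψ x)
          (downstream u₀ (fun y => c • (NormedSpace.exp (ψ y) - 1)) x) ∂μHE[d - 1] = 0 := by
      rw [← hcells]; exact h0
    linarith
  have hEs : M.IsPiecewiseSmooth fun x => E (ψ x) := hψ.isPiecewiseSmooth_comp hψ fun A _ => E A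
  have hEs₀ : M.IsPiecewiseSmooth fun x => E (ψ₀ x) :=
    hψ₀.isPiecewiseSmooth_comp hψ₀ fun A _ => E A
  have hns := (hus.norm_sq).const_mul (Re / 2)
  have hns₀ := (hus₀.norm_sq).const_mul (Re / 2)
  have hnd := ((hus.sub hus₀).norm_sq).const_mul (Re / 2)
  have hF : M.IsPiecewiseSmooth fun x => Re / 2 * ‖u x‖ ^ 2 + c * E (ψ x) :=
    hns.add (hEs.const_mul c)
  have hF₀ : M.IsPiecewiseSmooth fun x => Re / 2 * ‖u₀ x‖ ^ 2 + c * E (ψ₀ x) :=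
    hns₀.add (hEs₀.const_mul c)
  have hfree : freeEnergy D Re Wi ε u ψ = ∫ x in D, (Re / 2 * ‖u x‖ ^ 2 + c * E (ψ x)) := by
    rw [integral_add hns.integrableOn (hEs.const_mul c).integrableOn, integral_const_mul,
      integral_const_mul, freeEnergy]
  have hfree₀ : freeEnergy D Re Wi ε u₀ ψ₀ =
      ∫ x in D, (Re / 2 * ‖u₀ x‖ ^ 2 + c * E (ψ₀ x)) := by
    rw [integral_add hns₀.integrableOn (hEs₀.const_mul c).integrableOn, integral_const_mul,
      integral_const_mul, freeEnergy]
  have hconv := setIntegral_convection_eq_zero hd hD hν hu₀ hdiv hu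
  -- The density of the left-hand side plus the convection term. The latter integrates to zero, but
  -- it must be present for the pointwise bound `S ≤ Δt * R`.
  set S : Vec d → ℝ := fun x => (Re / 2 * ‖u x‖ ^ 2 + c * E (ψ x))
    - (Re / 2 * ‖u₀ x‖ ^ 2 + c * E (ψ₀ x)) + Re / 2 * ‖u x - u₀ x‖ ^ 2 + Δt * K x
    + Δt * Re * ⟪fderiv ℝ u x (u₀ x), u x⟫ with hS
  have hSs : M.IsPiecewiseSmooth S :=
    (((hF.sub hF₀).add hnd).add (hKs.const_mul Δt)).add (hTs.const_mul (Δt * Re))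
  have hSint : ∫ x in D, S x = freeEnergy D Re Wi ε u ψ - freeEnergy D Re Wi ε u₀ ψ₀
      + (∫ x in D, Re / 2 * ‖u x - u₀ x‖ ^ 2) + Δt * ∫ x in D, K x := by
    rw [hS, integral_add (((hF.sub hF₀).add hnd).add (hKs.const_mul Δt)).integrableOn
      (hTs.const_mul (Δt * Re)).integrableOn, integral_add ((hF.sub hF₀).add hnd).integrableOn
      (hKs.const_mul Δt).integrableOn, integral_add (hF.sub hF₀).integrableOn hnd.integrableOn,
      integral_sub hF.integrableOn hF₀.integrableOn, integral_const_mul (Δt * Re), hconv,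
      integral_const_mul Δt, hfree, hfree₀, mul_zero, add_zero]
  have hSR : ∫ x in D, S x ≤ Δt * ∫ x in D, R x := by
    rw [← integral_const_mul]
    refine integral_mono_ae hSs.integrableOn (hRs.const_mul Δt).integrableOn ?_
    filter_upwards [M.ae_mem_interior_cell] with x hx
    obtain ⟨s, hs, hxs⟩ := hx
    obtain ⟨A, hA, hAψ⟩ := hψ s hs
    obtain ⟨A₀, hA₀, hAψ₀⟩ := hψ₀ s hs
    have hklein := mul_le_mul_of_nonneg_left (trace_increment_le_ddot hA hA₀) hc0
    have hEd : (NormedSpace.exp A - A).trace - (NormedSpace.exp A₀ - A₀).trace = E A - E A₀ := by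
      simp only [hE, Matrix.trace_sub]; ring
    -- Polarization is exact and produces the numerical dissipation `‖u - u₀‖²`; only the `ψ`
    -- increment costs an inequality.
    have hnorm : ⟪u x - u₀ x, u x⟫ = (‖u x‖ ^ 2 - ‖u₀ x‖ ^ 2 + ‖u x - u₀ x‖ ^ 2) / 2 := by
      rw [norm_sub_sq_real, inner_sub_left, real_inner_self_eq_norm_sq, real_inner_comm (u x)]
      ring
    rw [hEd] at hklein
    simp only [hS, hR, hAψ x hxs, hAψ₀ x hxs, hnorm]
    have hm : Δt * (1 / Δt) = 1 := by field_simp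
    have : Δt * (Re * (1 / Δt * ((‖u x‖ ^ 2 - ‖u₀ x‖ ^ 2 + ‖u x - u₀ x‖ ^ 2) / 2))
        + Re * ⟪fderiv ℝ u x (u₀ x), u x⟫
        + 1 / Δt * (c * ddot (A - A₀) (NormedSpace.exp A - 1)) + K x) =
        Δt * (1 / Δt) * (Re * ((‖u x‖ ^ 2 - ‖u₀ x‖ ^ 2 + ‖u x - u₀ x‖ ^ 2) / 2)
          + c * ddot (A - A₀) (NormedSpace.exp A - 1))
        + Δt * Re * ⟪fderiv ℝ u x (u₀ x), u x⟫ + Δt * K x := by ring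
    rw [this, hm]
    linarith
  rw [← hSint]
  exact hSR.trans (mul_nonpos_of_nonneg_of_nonpos hΔt.le h1)

theorem setIntegral_dissipation_nonneg (hε₀ : 0 ≤ ε) (hε₁ : ε < 1) (hψ : M.IsStress ψ) :
    0 ≤ ∫ x in D, ((1 - ε) * ddot (grad u x) (grad u x)
            + ε / (2 * Wi ^ 2) * (NormedSpace.exp (ψ x) + NormedSpace.exp (-ψ x)
                - (2 : ℝ) • (1 : Mat d)).trace) := by
  refine integral_nonneg_of_ae ?_
  filter_upwards [M.ae_mem_interior_cell] with x hx
  obtain ⟨s, hs, hxs⟩ := hx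
  obtain ⟨A, hA, hAψ⟩ := hψ s hs
  rw [hAψ x hxs]
  have h1 := trace_exp_add_exp_neg_nonneg hA
  have h2 := ddot_self_nonneg (grad u x)
  have h3 : 0 ≤ 1 - ε := by linarith
  exact add_nonneg (mul_nonneg h3 h2) (mul_nonneg (by positivity) h1)

end OldroydB

theorem mainTheorem4 {d : ℕ} (hd : d = 2 ∨ d = 3)
    (D : Set (Vec d)) (hDo : IsOpen D) (hDb : Bornology.IsBounded D)
    (M : Mesh d D) (ν : Finset (Vec d) → Vec d) (hν : M.IsUnitNormal ν)
    (Re Wi ε : ℝ) (hRe : 0 ≤ Re) (hWi : 0 < Wi) (hε₀ : 0 ≤ ε) (hε₁ : ε < 1)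
    (T : ℝ) (hT : 0 < T) (NT : ℕ) (hNT : 0 < NT) (Δt : ℝ) (hΔt : Δt = T / NT)
    (u : ℕ → Vec d → Vec d) (p : ℕ → Vec d → ℝ) (ψ : ℕ → Vec d → Mat d)
    (hsol : IsLogP0DGSolution M ν Re Wi ε Δt NT u p ψ)
    (hdiv : M.IsDiscretelyDivFree (u 0)) :
    (∀ n < NT,
      freeEnergy D Re Wi ε (u (n + 1)) (ψ (n + 1)) - freeEnergy D Re Wi ε (u n) (ψ n)
        + (∫ x in D, Re / 2 * ‖u (n + 1) x - u n x‖ ^ 2)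
        + Δt * (∫ x in D,
            ((1 - ε) * ddot (grad (u (n + 1)) x) (grad (u (n + 1)) x)
              + ε / (2 * Wi ^ 2) *
                (NormedSpace.exp (ψ (n + 1) x) + NormedSpace.exp (-ψ (n + 1) x)
                  - (2 : ℝ) • (1 : Mat d)).trace)) ≤ 0) ∧
    AntitoneOn (fun n => freeEnergy D Re Wi ε (u n) (ψ n)) (Set.Iic NT) := by
  have hd2 : 2 ≤ d := by omega
  have hΔt0 : 0 < Δt := by rw [hΔt]; positivity
  -- Each step needs a divergence-free advecting field: given at time zero, and supplied by the
  -- preceding step afterwards.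
  have hstate : ∀ n ≤ NT, M.IsVelocity (u n) ∧ M.IsStress (ψ n) ∧ M.IsDiscretelyDivFree (u n) := by
    intro n hn
    cases n with
    | zero => exact ⟨hsol.velocity_zero, hsol.stress_zero, hdiv⟩
    | succ n =>
      have h := hsol.step n hn
      exact ⟨h.1, h.2.2.1, h.isDiscretelyDivFree⟩
  have hest := fun n (hn : n < NT) => (hsol.step n hn).freeEnergy_estimate hd2 hDo hν hWi hε₀ hΔt0
    (hstate n hn.le).1 (hstate n hn.le).2.1 (hstate n hn.le).2.2
  refine ⟨hest, ?_⟩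
  have hstep : ∀ n < NT, freeEnergy D Re Wi ε (u (n + 1)) (ψ (n + 1)) ≤
      freeEnergy D Re Wi ε (u n) (ψ n) := by
    intro n hn
    have h1 := hest n hn
    have h2 : 0 ≤ ∫ x in D, Re / 2 * ‖u (n + 1) x - u n x‖ ^ 2 :=
      integral_nonneg fun x => by positivity
    have h3 := mul_nonneg hΔt0.le (setIntegral_dissipation_nonneg (u := u (n + 1)) (Wi := Wi) hε₀ hε₁
      (hsol.step n hn).2.2.1)
    linarith
  intro m _ n hn hmn
  have hn' : n ≤ NT := hn
  induction n, hmn using Nat.le_induction with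
  | base => exact le_rfl
  | succ k _ ih =>
    have hk : k < NT := hn'
    exact (hstep k hk).trans (ih hk.le hk.le)
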